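/- Theorem 4.6. Let $\Omega\subseteq\mathbb C$ be an open set such that $(\mathbb C\cup\{\infty\})\setminus\overline{\Omega}$ is connected. Let $A^\infty(\Omega)$ be the space of holomorphic functions on $\Omega$ all of whose derivatives $f^{(\ell)}$, $\ell=0,1,2,\dots$, extend continuously to $\overline\Omega$ (the extensions are again denoted $f^{(\ell)}$), with the topology of uniform convergence of each derivative on each compact subset of $\overline\Omega$. Let $X^\infty$ be the closure in $A^\infty(\Omega)$ of the set of restrictions of functions holomorphic on some open set (depending on the function) containing $\overline\Omega$. Let $\mathcal F\subseteq\mathbb N\times\mathbb N$, where $\mathbb N=\{0,1,2,\dots\}$, contain a sequence $(\tilde p_n,\tilde q_n)_{n\ge1}$ with $\tilde p_n\to+\infty$, and fix $\zeta_0\in\overline\Omega$. For $f\in A^\infty(\Omega)$ put $a_v=f^{(v)}(\zeta_0)/v!$ for $v\ge 0$ and $a_v=0$ for $v<0$. Write $f\in\mathcal D_{p,q}(\zeta_0)$ if the Hankel determinant $\det(a_{p-q+1+i+j})_{0\le i,j<q}$ is nonzero (no condition if $q=0$). In that case $[p/q]_{f,\zeta_0}$ denotes the Padé approximant, that is, the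 unique rational function $\sum_{v=0}^p n_v(z-\zeta_0)^v\big/\sum_{v=0}^q d_v(z-\zeta_0)^v$ with $d_0=1$ whose Taylor coefficients at $\zeta_0$ of orders $0,\dots,p+q$ are $a_0,\dots,a_{p+q}$. Let $\mathcal S$ be the set of all $f\in A^\infty(\Omega)$ for which there is a sequence $(p_n,q_n)_{n\ge1}$ in $\mathcal F$ such that $f\in\mathcal D_{p_n,q_n}(\zeta_0)$ for all $n$ and, for every compact set $K\subseteq\overline\Omega$ and every $\ell=0,1,2,\dots$, $$\sup_{z\in K}\bigl|[p_n/q_n]^{(\ell)}_{f,\zeta_0}(z)-f^{(\ell)}(z)\bigr|\longrightarrow 0\qquad(n\to+\infty),$$ where it is understood that for each $K$ the function $[p_n/q_n]_{f,\zeta_0}$ has no poles in $K$ for all sufficiently large $n$. Then $\mathcal S$ is nonempty, $\mathcal S\subseteq X^\infty$, and $\mathcal S$ is a dense $G_\delta$ subset of $X^\infty$. Moreover, $X^\infty$ is the closure of the set of polynomials in $A^\infty(\Omega)$. -/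

import Mathlib

open Filter Topology
open scoped Polynomial PowerSeries

noncomputable section

/-- Extension by zero to the whole plane of a function given on `Ω`. When `Ω` is open, the
derivatives of the extension at the points of `Ω` are those of the function itself. -/
def extendZero {Ω : Set ℂ} (f : Ω → ℂ) : ℂ → ℂ :=
  Function.extend (Subtype.val : Ω → ℂ) f 0

/-- The space `A^∞(Ω)` (for open `Ω`): the holomorphic functions on `Ω` all of whose derivatives
`f^(l)`, `l = 0, 1, 2, …`, extend continuously to the closure of `Ω`. -/
def AInf (Ω : Set ℂ) : Type :=
  {f : Ω → ℂ // DifferentiableOn ℂ (extendZero f) Ω ∧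
    ∀ l : ℕ, ∃ g : C(closure Ω, ℂ), ∀ z : Ω,
      g ⟨z.1, subset_closure z.2⟩ = iteratedDeriv l (extendZero f) z.1}

namespace AInf

variable {Ω : Set ℂ}

/-- The continuous extension of the `l`-th derivative of `f` to the closure of `Ω`. It is
unique, because `Ω` is dense in its closure. -/
def derivExt (f : AInf Ω) (l : ℕ) : C(closure Ω, ℂ) :=
  (f.2.2 l).choose

/-- The topology of `A^∞(Ω)`: uniform convergence of each derivative on each compact subset of
the closure of `Ω` (the space `C(closure Ω, ℂ)` carries the compact-open topology). -/
instance : TopologicalSpace (AInf Ω) :=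
  TopologicalSpace.induced (fun f : AInf Ω => fun l : ℕ => f.derivExt l) inferInstance

/-- The `v`-th Taylor coefficient `f^(v)(ζ) / v!` of `f` at a point `ζ` of the closure of `Ω`. -/
def taylorCoeff (f : AInf Ω) (ζ : closure Ω) (v : ℕ) : ℂ :=
  f.derivExt v ζ / (v.factorial : ℂ)

end AInf

/-- The elements of `A^∞(Ω)` that are restrictions of functions holomorphic on some open set
containing the closure of `Ω` (the set `H(closure Ω)`). -/
def holoNearClosure (Ω : Set ℂ) : Set (AInf Ω) :=
  {f | ∃ U : Set ℂ, IsOpen U ∧ closure Ω ⊆ U ∧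
    ∃ g : ℂ → ℂ, DifferentiableOn ℂ g U ∧ ∀ z : Ω, f.1 z = g z.1}

/-- The elements of `A^∞(Ω)` that are restrictions of polynomials. -/
def polynomialRestrictions (Ω : Set ℂ) : Set (AInf Ω) :=
  {f | ∃ P : ℂ[X], ∀ z : Ω, f.1 z = P.eval z.1}

/-- The space `X^∞`: the closure of `H(closure Ω)` in `A^∞(Ω)`. -/
def XInf (Ω : Set ℂ) : Set (AInf Ω) :=
  closure (holoNearClosure Ω)

/-- The coefficients of a power series, with `a_i = 0` when `i < 0`. -/
def coeffInt (a : ℕ → ℂ) (i : ℤ) : ℂ :=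
  if i < 0 then 0 else a i.toNat

/-- The `q × q` Hankel matrix with the entries `a_{p-q+1+i+j}`, where `0 ≤ i, j < q`. -/
def hankel (a : ℕ → ℂ) (p q : ℕ) : Matrix (Fin q) (Fin q) ℂ :=
  Matrix.of fun i j => coeffInt a ((p : ℤ) - (q : ℤ) + 1 + ((i : ℕ) : ℤ) + ((j : ℕ) : ℤ))

/-- The class `𝒟_{p,q}`: the Hankel determinant does not vanish. For `q = 0` it is the empty
determinant, which is `1`, so that there is no condition. -/
def InD (a : ℕ → ℂ) (p q : ℕ) : Prop :=
  (hankel a p q).det ≠ 0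

/-- `R` (a rational function of the local variable `t = z - ζ`) is a `[p/q]` Padé approximant of
the formal series `∑ a_v t^v`: it is of the form `N / D` with `deg N ≤ p`, `deg D ≤ q` and
`D(0) = 1`, and the first `p + q + 1` terms of its Taylor series are `a_0, …, a_{p+q}`. -/
def IsPade (a : ℕ → ℂ) (p q : ℕ) (R : RatFunc ℂ) : Prop :=
  ∃ N D : ℂ[X], N.natDegree ≤ p ∧ D.natDegree ≤ q ∧ D.coeff 0 = 1 ∧
    R = algebraMap ℂ[X] (RatFunc ℂ) N / algebraMap ℂ[X] (RatFunc ℂ) D ∧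
    ∀ v : ℕ, v ≤ p + q → PowerSeries.coeff v ((N : ℂ⟦X⟧) * (D : ℂ⟦X⟧)⁻¹) = a v

/-- The value at `z` of the rational function `R` of the local variable `z - ζ`
(meaningful where `R` has no pole). -/
def ratValue (R : RatFunc ℂ) (ζ z : ℂ) : ℂ :=
  R.num.eval (z - ζ) / R.denom.eval (z - ζ)

/-- The rational function `R` of the local variable `z - ζ` has a pole at `z`
(`RatFunc.num` and `RatFunc.denom` are coprime). -/
def HasPole (R : RatFunc ℂ) (ζ z : ℂ) : Prop :=
  R.denom.eval (z - ζ) = 0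

/-- There is a sequence `(p_n, q_n)` in `F` such that `f ∈ 𝒟_{p_n,q_n}(ζ)` for all `n` and, for
every compact subset `K` of the closure of `Ω` and every `l`, the `l`-th derivatives of the
Padé approximants `R n = [p_n/q_n]_{f,ζ}` converge to `f^(l)` uniformly on `K`; the finiteness of
the suprema for large `n` means that the approximants then have no poles in `K`.
Membership in `𝒟_{p_n,q_n}(ζ)` makes the Padé approximant unique. -/
def PadeApproximable {Ω : Set ℂ} (F : Set (ℕ × ℕ)) (ζ : closure Ω) (f : AInf Ω) : Prop :=
  ∃ (p q : ℕ → ℕ) (R : ℕ → RatFunc ℂ),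
    (∀ n, (p n, q n) ∈ F) ∧
    (∀ n, InD (f.taylorCoeff ζ) (p n) (q n)) ∧
    (∀ n, IsPade (f.taylorCoeff ζ) (p n) (q n) (R n)) ∧
    ∀ K : Set (closure Ω), IsCompact K →
      (∀ᶠ n in atTop, ∀ z ∈ K, ¬ HasPole (R n) ζ.1 z.1) ∧
      ∀ l : ℕ, TendstoUniformlyOn
        (fun (n : ℕ) (z : closure Ω) => iteratedDeriv l (ratValue (R n) ζ.1) z.1)
        (fun z : closure Ω => f.derivExt l z) atTop K

end

/-! Two facts carry the theorem: Runge's theorem with control of derivatives, and the Baire category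
theorem in the closed subspace `XInf Ω` of a completely metrizable space.

Since the sphere minus the closure of `Ω` is connected, a function holomorphic near the intersection
of that closure with a closed disc can be approximated there by polynomials, together with finitely
many derivatives (`polyApprox_inter_closedBall`). Such intersections exhaust the closure of `Ω`, so
polynomials are dense in `XInf Ω`. A Padé approximant without poles on a bounded part is holomorphic
near it, so every limit of such approximants also lies in `XInf Ω`.

The Padé approximable functions are the intersection over `s` of the sets `padeClose F ζ s`
(`padeApproximable_iff`). Each is open: by Cramer's rule numerator and denominator, up to the common
factor given by the Hankel determinant, have coefficients polynomial in the Taylor coefficients,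
hence continuous in `f`, and compactness makes the estimate uniform in `z` (`isOpen_padeClose`).
Each is dense in `XInf Ω`: a polynomial of degree exactly `p` has nonzero Hankel determinants for
`(p, q)`, whatever `q`, and is its own approximant; any polynomial becomes of this kind after adding
`c X ^ p` with `c` small and `p` a large first index available in `F`. Baire's theorem concludes.

Runge's theorem is obtained from a Cauchy–Pompeiu formula, which reduces it to simple fractions,
followed by pole pushing. -/

noncomputable section

/-! ### The Cauchy–Pompeiu formula on a square -/

/-- The integral of `(z - w)⁻¹` over the boundary of the square `[-N, N]²`. -/
def squareWinding (N : ℝ) (w : ℂ) : ℂ :=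
  (∫ x : ℝ in (-N)..N, ((x + (-N : ℝ) * Complex.I : ℂ) - w)⁻¹)
    - (∫ x : ℝ in (-N)..N, ((x + N * Complex.I : ℂ) - w)⁻¹)
    + Complex.I • (∫ y : ℝ in (-N)..N, ((N + y * Complex.I : ℂ) - w)⁻¹)
    - Complex.I • ∫ y : ℝ in (-N)..N, (((-N : ℝ) + y * Complex.I : ℂ) - w)⁻¹

lemma norm_le_of_le_abs_re {N : ℝ} {z : ℂ} (h : N ≤ |z.re| ∨ N ≤ |z.im|) : N ≤ ‖z‖ := by
  rcases h with h | h
  · exact h.trans (Complex.abs_re_le_norm z)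
  · exact h.trans (Complex.abs_im_le_norm z)

/-- The principal branch suffices: `‖w / z‖ < 1` puts `1 - w / z` in the right half-plane. -/
lemma hasDerivAt_log_one_sub_div {z w : ℂ} (h : ‖w‖ < ‖z‖) :
    HasDerivAt (fun z => Complex.log (1 - w / z)) ((z - w)⁻¹ - z⁻¹) z := by
  have hz : z ≠ 0 := by
    rintro rfl
    simp at h
    exact absurd h (not_lt.2 (norm_nonneg _))
  have hzw : z - w ≠ 0 := by
    intro h0
    rw [sub_eq_zero] at h0
    simp [h0] at h
  have hs : 1 - w / z ∈ Complex.slitPlane := by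
    left
    have h1 : ‖w / z‖ < 1 := by
      rw [norm_div, div_lt_one (norm_pos_iff.2 hz)]
      exact h
    have h2 := (Complex.re_le_norm (w / z)).trans_lt h1
    simp only [Complex.sub_re, Complex.one_re]
    linarith
  have h1 : HasDerivAt (fun z : ℂ => 1 - w / z) (w / z ^ 2) z := by
    have := ((hasDerivAt_inv hz).const_mul w).const_sub 1
    simpa [div_eq_mul_inv] using this
  convert h1.clog hs using 1
  have h3 : 1 - w / z ≠ 0 := by
    have : 1 - w / z = (z - w) / z := by field_simp
    rw [this]
    exact div_ne_zero hzw hz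
  field_simp
  ring

lemma integral_inv_sub_sub_integral_inv {N : ℝ} {w : ℂ} (γ : ℝ → ℂ) (d : ℂ)
    (hγ : ∀ t, HasDerivAt γ d t) (hw : ∀ t, ‖w‖ < ‖γ t‖) :
    d * (∫ t in (-N)..N, (γ t - w)⁻¹) - d * ∫ t in (-N)..N, (γ t)⁻¹ =
      Complex.log (1 - w / γ N) - Complex.log (1 - w / γ (-N)) := by
  have hc : Continuous γ := continuous_iff_continuousAt.2 fun t => (hγ t).continuousAt
  have h0 : ∀ t, γ t ≠ 0 := fun t h => by
    have := hw t
    rw [h, norm_zero] at this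
    exact absurd this (not_lt.2 (norm_nonneg _))
  have h1 : ∀ t, γ t - w ≠ 0 := fun t h => by
    have := hw t
    rw [sub_eq_zero.1 h] at this
    exact lt_irrefl _ this
  have c1 : Continuous fun t => (γ t - w)⁻¹ := (hc.sub continuous_const).inv₀ h1
  have c2 : Continuous fun t => (γ t)⁻¹ := hc.inv₀ h0
  rw [← mul_sub, ← intervalIntegral.integral_sub (c1.intervalIntegrable _ _)
    (c2.intervalIntegrable _ _), ← intervalIntegral.integral_const_mul]
  refine intervalIntegral.integral_eq_sub_of_hasDerivAt (f := fun t => Complex.log (1 - w / γ t))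
    (fun t _ => ?_) ((continuous_const.mul (c1.sub c2)).intervalIntegrable _ _)
  have := (hasDerivAt_log_one_sub_div (hw t)).scomp t (hγ t)
  rwa [smul_eq_mul] at this

lemma hasDerivAt_ofReal_add (c : ℂ) (t : ℝ) : HasDerivAt (fun x : ℝ => (x + c : ℂ)) 1 t :=
  Complex.ofRealCLM.hasDerivAt.add_const c

lemma hasDerivAt_add_ofReal_mul_I (c : ℂ) (t : ℝ) :
    HasDerivAt (fun y : ℝ => (c + y * Complex.I : ℂ)) Complex.I t := by
  have h : HasDerivAt (fun y : ℝ => (y : ℂ)) 1 t := Complex.ofRealCLM.hasDerivAt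
  simpa using (h.mul_const Complex.I).const_add c

/-- On each side, `(z - w)⁻¹ - z⁻¹` has the single-valued primitive `log (1 - w / z)`, and the
corner values cancel around the square. With the nonvanishing at `0`, this replaces the explicit
value `2πi`, which is never needed. -/
lemma squareWinding_eq {N : ℝ} {w : ℂ} (hw : ‖w‖ < N) :
    squareWinding N w = squareWinding N 0 := by
  have hN : 0 < N := (norm_nonneg w).trans_lt hw
  have e1 := integral_inv_sub_sub_integral_inv (N := N) (w := w)
    (fun x : ℝ => (x + (-N : ℝ) * Complex.I : ℂ)) 1
    (hasDerivAt_ofReal_add _)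
    (fun t => hw.trans_le (norm_le_of_le_abs_re (Or.inr (by simp [abs_of_pos hN]))))
  have e2 := integral_inv_sub_sub_integral_inv (N := N) (w := w)
    (fun x : ℝ => (x + N * Complex.I : ℂ)) 1
    (hasDerivAt_ofReal_add _)
    (fun t => hw.trans_le (norm_le_of_le_abs_re (Or.inr (by simp [abs_of_pos hN]))))
  have e3 := integral_inv_sub_sub_integral_inv (N := N) (w := w)
    (fun y : ℝ => (N + y * Complex.I : ℂ)) Complex.I
    (hasDerivAt_add_ofReal_mul_I _)
    (fun t => hw.trans_le (norm_le_of_le_abs_re (Or.inl (by simp [abs_of_pos hN]))))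
  have e4 := integral_inv_sub_sub_integral_inv (N := N) (w := w)
    (fun y : ℝ => ((-N : ℝ) + y * Complex.I : ℂ)) Complex.I
    (hasDerivAt_add_ofReal_mul_I _)
    (fun t => hw.trans_le (norm_le_of_le_abs_re (Or.inl (by simp [abs_of_pos hN]))))
  simp only [squareWinding, smul_eq_mul, sub_zero]
  linear_combination e1 - e2 + e3 - e4

/-- Combining the four sides leaves `4i` times the integral of a positive function. -/
lemma squareWinding_zero_ne_zero {N : ℝ} (hN : 0 < N) : squareWinding N 0 ≠ 0 := by
  have hne1 : ∀ (s : ℝ), s ≠ 0 → ∀ x : ℝ, (x + s * Complex.I : ℂ) ≠ 0 := fun s hs x h => by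
    have := congrArg Complex.im h
    simp at this
    exact hs this
  have hne2 : ∀ (s : ℝ), s ≠ 0 → ∀ x : ℝ, (s + x * Complex.I : ℂ) ≠ 0 := fun s hs x h => by
    have := congrArg Complex.re h
    simp at this
    exact hs this
  have hN' : -N ≠ 0 := by linarith [hN.ne']
  have i1 : ∀ s : ℝ, s ≠ 0 →
      IntervalIntegrable (fun x : ℝ => (x + s * Complex.I : ℂ)⁻¹) MeasureTheory.volume (-N) N :=
    fun s hs => (Continuous.inv₀ (by fun_prop) (hne1 s hs)).intervalIntegrable _ _
  have i2 : ∀ s : ℝ, s ≠ 0 →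
      IntervalIntegrable (fun x : ℝ => (s + x * Complex.I : ℂ)⁻¹) MeasureTheory.volume (-N) N :=
    fun s hs => (Continuous.inv₀ (by fun_prop) (hne2 s hs)).intervalIntegrable _ _
  have key : squareWinding N 0 =
      4 * Complex.I * ((∫ x in (-N)..N, N / (x ^ 2 + N ^ 2) : ℝ) : ℂ) := by
    simp only [squareWinding, sub_zero, smul_eq_mul]
    rw [← intervalIntegral.integral_sub (i1 _ hN') (i1 _ hN.ne'), add_sub_assoc, ← mul_sub,
      ← intervalIntegral.integral_sub (i2 _ hN.ne') (i2 _ hN'), ← intervalIntegral.integral_ofReal,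
      ← intervalIntegral.integral_const_mul, ← intervalIntegral.integral_const_mul,
      ← intervalIntegral.integral_add]
    · refine intervalIntegral.integral_congr fun x _ => ?_
      have a1 := hne1 N hN.ne' x
      have a2 := hne1 _ hN' x
      have a3 := hne2 N hN.ne' x
      have a4 := hne2 _ hN' x
      have a5 : ((x : ℂ) ^ 2 + N ^ 2) ≠ 0 := by
        have : (0 : ℝ) < x ^ 2 + N ^ 2 := by positivity
        exact_mod_cast this.ne'
      have b1 : ((x + (-N : ℝ) * Complex.I : ℂ))⁻¹ = (x + N * Complex.I) / (x ^ 2 + N ^ 2) := by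
        rw [inv_eq_one_div, div_eq_div_iff a2 a5]
        push_cast
        linear_combination ((N : ℂ) ^ 2) * Complex.I_sq
      have b2 : ((x + N * Complex.I : ℂ))⁻¹ = (x - N * Complex.I) / (x ^ 2 + N ^ 2) := by
        rw [inv_eq_one_div, div_eq_div_iff a1 a5]
        linear_combination ((N : ℂ) ^ 2) * Complex.I_sq
      have b3 : ((N + x * Complex.I : ℂ))⁻¹ = (N - x * Complex.I) / (x ^ 2 + N ^ 2) := by
        rw [inv_eq_one_div, div_eq_div_iff a3 a5]
        linear_combination ((x : ℂ) ^ 2) * Complex.I_sq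
      have b4 : (((-N : ℝ) + x * Complex.I : ℂ))⁻¹ = (-N - x * Complex.I) / (x ^ 2 + N ^ 2) := by
        rw [inv_eq_one_div, div_eq_div_iff a4 a5]
        push_cast
        linear_combination ((x : ℂ) ^ 2) * Complex.I_sq
      simp only [b1, b2, b3, b4]
      push_cast
      field_simp
      ring
    · exact (i1 _ hN').sub (i1 _ hN.ne')
    · exact ((i2 _ hN.ne').sub (i2 _ hN')).const_mul _
  have hpos : 0 < ∫ x in (-N)..N, N / (x ^ 2 + N ^ 2) := by
    refine intervalIntegral.intervalIntegral_pos_of_pos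
      (Continuous.intervalIntegrable ?_ _ _) (fun x => by positivity) (by linarith)
    exact continuous_const.div (by fun_prop) fun x => by positivity
  rw [key]
  exact mul_ne_zero (mul_ne_zero (by norm_num) Complex.I_ne_zero)
    (Complex.ofReal_ne_zero.2 hpos.ne')

/-- The Wirtinger derivative `∂g/∂z̄`, up to the factor `2i`. -/
def dbar (g : ℂ → ℂ) (z : ℂ) : ℂ :=
  Complex.I * fderiv ℝ g z 1 - fderiv ℝ g z Complex.I

lemma dbar_eq_zero {g : ℂ → ℂ} {z : ℂ} (h : DifferentiableAt ℂ g z) : dbar g z = 0 := by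
  rw [dbar, (h.hasFDerivAt.restrictScalars ℝ).fderiv]
  simp only [ContinuousLinearMap.coe_restrictScalars']
  have := (fderiv ℂ g z).map_smul Complex.I 1
  simp only [smul_eq_mul, mul_one] at this
  rw [this, sub_self]

lemma continuous_dbar {g : ℂ → ℂ} (hg : ContDiff ℝ 1 g) : Continuous (dbar g) := by
  have := hg.continuous_fderiv one_ne_zero
  unfold dbar
  fun_prop

/-- The kernel is singular only for `z = w ∈ K ⊆ V`, and there `dbar g` vanishes in a neighbourhood.
-/
lemma continuous_inv_sub_mul_dbar {g : ℂ → ℂ} (hg : ContDiff ℝ 1 g) {V : Set ℂ} (hV : IsOpen V)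
    (hgV : DifferentiableOn ℂ g V) {K : Set ℂ} (hKV : K ⊆ V) :
    Continuous fun p : ℂ × K => (p.1 - p.2.1)⁻¹ * dbar g p.1 := by
  rw [continuous_iff_continuousAt]
  rintro ⟨z, w⟩
  by_cases hz : z ∈ V
  · have : (fun p : ℂ × K => (p.1 - p.2.1)⁻¹ * dbar g p.1) =ᶠ[𝓝 (z, w)] fun _ => 0 := by
      filter_upwards [(hV.preimage continuous_fst).mem_nhds (show (z, w).1 ∈ V from hz)] with p hp
      rw [dbar_eq_zero (hgV.differentiableAt (hV.mem_nhds hp)), mul_zero]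
    exact continuousAt_const.congr this.symm
  · have hne : z - w.1 ≠ 0 := fun h => hz (sub_eq_zero.1 h ▸ hKV w.2)
    exact ContinuousAt.mul (ContinuousAt.inv₀ (by fun_prop) hne)
      ((continuous_dbar hg).continuousAt.comp continuousAt_fst)

/-- The real derivative of `dslope g w` off `w`. -/
def dslopeFDeriv (g : ℂ → ℂ) (w z : ℂ) : ℂ →L[ℝ] ℂ :=
  (z - w)⁻¹ • fderiv ℝ g z - ((g z - g w) * ((z - w) ^ 2)⁻¹) • ContinuousLinearMap.id ℝ ℂ

/-- The multiple of the identity is complex linear, so it contributes nothing. -/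
lemma I_smul_dslopeFDeriv_sub (g : ℂ → ℂ) (w z : ℂ) :
    Complex.I • dslopeFDeriv g w z 1 - dslopeFDeriv g w z Complex.I = (z - w)⁻¹ * dbar g z := by
  simp only [dslopeFDeriv, dbar, _root_.sub_apply, _root_.smul_apply,
    smul_eq_mul, ContinuousLinearMap.id_apply]
  ring

lemma hasFDerivAt_dslope {g : ℂ → ℂ} {w z : ℂ} (hg : DifferentiableAt ℝ g z) (hz : z ≠ w) :
    HasFDerivAt (dslope g w) (dslopeFDeriv g w z) z := by
  have hzw : z - w ≠ 0 := sub_ne_zero.2 hz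
  have h1 : HasFDerivAt (fun z : ℂ => (z - w)⁻¹)
      ((-((z - w) ^ 2)⁻¹) • ContinuousLinearMap.id ℝ ℂ) z := by
    have := (((hasDerivAt_id z).sub_const w).inv hzw).hasFDerivAt.restrictScalars ℝ
    refine this.congr_fderiv (ContinuousLinearMap.ext fun v => ?_)
    simp [div_eq_mul_inv, mul_comm]
  have h2 : HasFDerivAt (fun z => g z - g w) (fderiv ℝ g z) z := hg.hasFDerivAt.sub_const _
  have h3 := h1.mul h2
  have h4 : dslope g w =ᶠ[𝓝 z] fun z => (z - w)⁻¹ * (g z - g w) := by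
    filter_upwards [isOpen_ne.mem_nhds hz] with u hu
    rw [dslope_of_ne _ hu, slope_def_field, div_eq_inv_mul]
  refine (h3.congr_of_eventuallyEq h4).congr_fderiv (ContinuousLinearMap.ext fun v => ?_)
  simp only [dslopeFDeriv, _root_.sub_apply, _root_.add_apply,
    _root_.smul_apply, smul_eq_mul, ContinuousLinearMap.id_apply]
  ring

/-- A form of the Cauchy–Pompeiu formula. -/
lemma cauchy_pompeiu {g : ℂ → ℂ} (hg : ContDiff ℝ 1 g) {V : Set ℂ} (hV : IsOpen V)
    (hgV : DifferentiableOn ℂ g V) {N : ℝ} (hgN : ∀ z, N ≤ ‖z‖ → g z = 0) {w : ℂ} (hw : w ∈ V)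
    (hwN : ‖w‖ < N) :
    -squareWinding N 0 * g w =
      ∫ x : ℝ in (-N)..N, ∫ y : ℝ in (-N)..N,
        ((x + y * Complex.I : ℂ) - w)⁻¹ * dbar g (x + y * Complex.I) := by
  have hN : 0 < N := (norm_nonneg w).trans_lt hwN
  have hcont : Continuous fun z => (z - w)⁻¹ * dbar g z := by
    have hKV : ({w} : Set ℂ) ⊆ V := Set.singleton_subset_iff.2 hw
    have h : Continuous fun z : ℂ => (z, (⟨w, Set.mem_singleton w⟩ : ({w} : Set ℂ))) := by fun_prop
    exact (continuous_inv_sub_mul_dbar hg hV hgV hKV).comp h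
  have hdb := I_smul_dslopeFDeriv_sub g w
  have hc : Continuous (dslope g w) := continuous_iff_continuousAt.2 fun z => by
    by_cases hz : z = w
    · subst hz
      exact continuousAt_dslope_same.2 (hgV.differentiableAt (hV.mem_nhds hw))
    · exact (continuousAt_dslope_of_ne hz).2 hg.continuous.continuousAt
  have hi : MeasureTheory.IntegrableOn
      (fun z => Complex.I • dslopeFDeriv g w z 1 - dslopeFDeriv g w z Complex.I)
      (Set.uIcc (-N) N ×ℂ Set.uIcc (-N) N) := by
    simp only [hdb]
    exact hcont.continuousOn.integrableOn_compact (isCompact_uIcc.reProdIm isCompact_uIcc)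
  -- Green's formula for the difference quotient of `g` at `w`: it is continuous at `w` because `g`
  -- is holomorphic there, so `w` can be the exceptional point.
  have H := Complex.integral_boundary_rect_of_hasFDerivAt_real_off_countable
    (dslope g w) (dslopeFDeriv g w) (⟨-N, -N⟩ : ℂ) (⟨N, N⟩ : ℂ) {w} (Set.countable_singleton w)
    hc.continuousOn
    (fun z hz => hasFDerivAt_dslope ((hg.differentiable one_ne_zero) z) hz.2) hi
  simp only [hdb] at H
  rw [← H, ← squareWinding_eq hwN]
  -- On the boundary `g` vanishes, and the difference quotient reduces to the Cauchy kernel times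
  -- `-g w`.
  have hs : ∀ z : ℂ, N ≤ |z.re| ∨ N ≤ |z.im| → dslope g w z = -g w * (z - w)⁻¹ := fun z hz => by
    have hz := norm_le_of_le_abs_re hz
    have : z ≠ w := by
      rintro rfl
      exact absurd hwN (not_lt.2 hz)
    rw [dslope_of_ne _ this, slope_def_field, hgN z hz]
    ring
  have s1 : ∀ x : ℝ, dslope g w (x + (-N : ℝ) * Complex.I : ℂ) =
      -g w * ((x + (-N : ℝ) * Complex.I : ℂ) - w)⁻¹ := fun x =>
    hs _ (Or.inr (by simp [abs_of_pos hN]))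
  have s2 : ∀ x : ℝ, dslope g w (x + N * Complex.I : ℂ) =
      -g w * ((x + N * Complex.I : ℂ) - w)⁻¹ := fun x =>
    hs _ (Or.inr (by simp [abs_of_pos hN]))
  have s3 : ∀ x : ℝ, dslope g w (N + x * Complex.I : ℂ) =
      -g w * ((N + x * Complex.I : ℂ) - w)⁻¹ := fun x =>
    hs _ (Or.inl (by simp [abs_of_pos hN]))
  have s4 : ∀ x : ℝ, dslope g w ((-N : ℝ) + x * Complex.I : ℂ) =
      -g w * (((-N : ℝ) + x * Complex.I : ℂ) - w)⁻¹ := fun x =>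
    hs _ (Or.inl (by simp [abs_of_pos hN]))
  simp only [s1, s2, s3, s4, intervalIntegral.integral_const_mul, squareWinding, smul_eq_mul]
  ring

/-! ### Approximation by simple fractions -/

/-- The span of the functions `w ↦ (a - w)⁻¹`, `a ∉ K`, in `C(K, ℂ)`. -/
def simplePoleSpan (K : Set ℂ) : Submodule ℂ C(K, ℂ) :=
  Submodule.span ℂ {φ | ∃ a ∉ K, ∀ w : K, φ w = (a - w.1)⁻¹}

lemma intervalIntegral_mem_of_isClosed {E : Type*} [NormedAddCommGroup E] [NormedSpace ℂ E]
    [CompleteSpace E] (M : Submodule ℂ E) (hM : IsClosed (M : Set E)) {φ : ℝ → E}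
    (hφ : Continuous φ) (hm : ∀ t, φ t ∈ M) (a b : ℝ) : ∫ t in a..b, φ t ∈ M := by
  have : CompleteSpace M := hM.completeSpace_coe
  have hc : Continuous fun t => (⟨φ t, hm t⟩ : M) := hφ.subtype_mk _
  have := M.subtypeL.intervalIntegral_comp_comm
    (hc.intervalIntegrable (μ := MeasureTheory.volume) a b)
  simp only [Submodule.subtypeL_apply] at this
  rw [this]
  exact Subtype.property _

/-- A function holomorphic near a compact set `K` is, on some compact neighbourhood of `K`, a
uniform limit of linear combinations of simple fractions with poles off the neighbourhood. -/
lemma exists_mem_closure_simplePoleSpan {K U : Set ℂ} (hK : IsCompact K) (hU : IsOpen U)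
    (hKU : K ⊆ U) {f : ℂ → ℂ} (hf : DifferentiableOn ℂ f U) :
    ∃ L : Set ℂ, IsCompact L ∧ K ⊆ interior L ∧ L ⊆ U ∧
      ∃ φ : C(L, ℂ), (∀ w : L, φ w = f w) ∧ φ ∈ (simplePoleSpan L).topologicalClosure := by
  -- The nesting is `K ⊆ int L`, `L ⊆ int L₂`, `L₂ ⊆ int L₁`, `L₁ ⊆ U`. The cutoff is `1` on `L₂`
  -- and `0` off `int L₁`, so `g = χ f` is globally `C¹` and holomorphic around `L`.
  obtain ⟨L₁, hL₁, hKL₁, hL₁U⟩ := exists_compact_between hK hU hKU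
  obtain ⟨L, hL, hKL, hLL₁⟩ := exists_compact_between hK isOpen_interior hKL₁
  obtain ⟨L₂, hL₂, hLL₂, hL₂L₁⟩ := exists_compact_between hL isOpen_interior hLL₁
  obtain ⟨χ, hχ1, hχ0, hχ⟩ : ∃ χ : ℂ → ℝ, (∀ z ∈ L₂, χ z = 1) ∧ (∀ z ∉ interior L₁, χ z = 0) ∧
      ContDiff ℝ 1 χ := by
    obtain ⟨χ, h1, h0, -⟩ := exists_contMDiffMap_one_nhds_of_subset_interior (n := 1)
      (modelWithCornersSelf ℝ ℂ) (s := L₂) (t := interior L₁) hL₂.isClosed (by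
        rwa [interior_interior])
    refine ⟨χ, fun z hz => ?_, fun z hz => h0 z hz, χ.contMDiff.contDiff⟩
    exact (h1.filter_mono (nhds_le_nhdsSet hz)).self_of_nhds
  refine ⟨L, hL, hKL, hLL₁.trans (interior_subset.trans hL₁U), ?_⟩
  set g : ℂ → ℂ := fun z => (χ z : ℂ) * f z with hg
  have hgC : ContDiff ℝ 1 g := by
    rw [contDiff_iff_contDiffAt]
    intro z
    by_cases hz : z ∈ U
    · have h1 : ContDiffAt ℝ 1 f z :=
        ((hf.analyticAt (hU.mem_nhds hz)).contDiffAt (n := 1)).restrict_scalars ℝ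
      exact (Complex.ofRealCLM.contDiff.contDiffAt.comp z hχ.contDiffAt).mul h1
    · have h0 : g =ᶠ[𝓝 z] fun _ => 0 := by
        filter_upwards [hL₁.isClosed.isOpen_compl.mem_nhds (fun h => hz (hL₁U h))] with u hu
        simp [hg, hχ0 u (fun h => hu (interior_subset h))]
      exact contDiffAt_const.congr_of_eventuallyEq h0
  have hgf : ∀ z ∈ L₂, g z = f z := fun z hz => by simp [hg, hχ1 z hz]
  have hgV : DifferentiableOn ℂ g (interior L₂) := by
    refine (hf.mono ?_).congr fun z hz => hgf z (interior_subset hz)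
    exact interior_subset.trans (hL₂L₁.trans (interior_subset.trans hL₁U))
  obtain ⟨N, hN⟩ := (hL₁.isBounded.subset_ball_lt 0 0)
  have hL₁N : ∀ z ∈ L₁, ‖z‖ < N := fun z hz => by simpa using hN.2 hz
  have hgN : ∀ z, N ≤ ‖z‖ → g z = 0 := fun z hz => by
    simp [hg, hχ0 z fun h => absurd (hL₁N z (interior_subset h)) (not_lt.2 hz)]
  have : CompactSpace L := isCompact_iff_compactSpace.1 hL
  set c := squareWinding N 0
  have hc : c ≠ 0 := squareWinding_zero_ne_zero hN.1
  have hcont := continuous_inv_sub_mul_dbar hgC isOpen_interior hgV hLL₂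
  -- The kernel as a continuous function of `z` with values in `C(L, ℂ)`: each value is a multiple
  -- of one simple fraction with pole off `L`, or `0` if `z ∈ L`. Its integral therefore stays in
  -- the closed span.
  set Φ : C(ℂ, C(L, ℂ)) := ContinuousMap.curry ⟨_, hcont⟩ with hΦ
  have hΦc : Continuous Φ := ContinuousMap.continuous _
  have hΦM : ∀ z, Φ z ∈ (simplePoleSpan L).topologicalClosure := fun z => by
    apply Submodule.le_topologicalClosure
    by_cases hz : z ∈ L
    · have : Φ z = 0 := by
        ext w
        simp [hΦ, dbar_eq_zero (hgV.differentiableAt (isOpen_interior.mem_nhds (hLL₂ hz)))]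
      rw [this]
      exact Submodule.zero_mem _
    · have hcz : Continuous fun w : L => (z - w.1)⁻¹ :=
        Continuous.inv₀ (by fun_prop) fun w h => hz (sub_eq_zero.1 h ▸ w.2)
      have : Φ z = dbar g z • (⟨_, hcz⟩ : C(L, ℂ)) := by
        ext w
        simp [hΦ, mul_comm]
      rw [this]
      exact Submodule.smul_mem _ _ (Submodule.subset_span ⟨z, hz, fun w => rfl⟩)
  have hΦ2 : Continuous fun p : ℝ × ℝ => Φ (p.1 + p.2 * Complex.I) :=
    hΦc.comp (by fun_prop)
  have hin : Continuous fun x : ℝ => ∫ y : ℝ in (-N)..N, Φ (x + y * Complex.I) :=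
    intervalIntegral.continuous_parametric_intervalIntegral_of_continuous' hΦ2 _ _
  have hclosed : IsClosed ((simplePoleSpan L).topologicalClosure : Set C(L, ℂ)) :=
    Submodule.isClosed_topologicalClosure _
  refine ⟨(-c)⁻¹ • ∫ x : ℝ in (-N)..N, ∫ y : ℝ in (-N)..N, Φ (x + y * Complex.I), fun w => ?_,
    Submodule.smul_mem _ _ (intervalIntegral_mem_of_isClosed _ hclosed hin (fun x =>
      intervalIntegral_mem_of_isClosed _ hclosed
        (hΦ2.comp (Continuous.prodMk_right x)) (fun y => hΦM _) _ _) _ _)⟩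
  have hwL₁ : w.1 ∈ L₁ := interior_subset (hLL₁ w.2)
  have hcp := cauchy_pompeiu hgC isOpen_interior hgV hgN (hLL₂ w.2) (hL₁N w hwL₁)
  rw [hgf w (interior_subset (hLL₂ w.2))] at hcp
  have hev := (ContinuousMap.evalCLM ℂ w).intervalIntegral_comp_comm
    (hin.intervalIntegrable (μ := MeasureTheory.volume) (-N) N)
  have hev2 : ∀ x : ℝ, (∫ y : ℝ in (-N)..N, Φ (x + y * Complex.I)) w =
      ∫ y : ℝ in (-N)..N, Φ (x + y * Complex.I) w := fun x =>
    ((ContinuousMap.evalCLM ℂ w).intervalIntegral_comp_comm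
      ((hΦ2.comp (Continuous.prodMk_right x)).intervalIntegrable
        (μ := MeasureTheory.volume) (-N) N)).symm
  simp only [ContinuousMap.evalCLM_apply, hev2] at hev
  rw [ContinuousMap.smul_apply, ← hev, smul_eq_mul, inv_mul_eq_iff_eq_mul₀ (neg_ne_zero.2 hc)]
  exact hcp.symm

/-! ### Runge's theorem with derivatives -/

lemma iteratedDeriv_polynomial (P : ℂ[X]) (l : ℕ) (z : ℂ) :
    iteratedDeriv l (fun z => P.eval z) z = (Polynomial.derivative^[l] P).eval z := by
  induction l generalizing P with
  | zero => simp
  | succ l ih =>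
    have : deriv (fun z => P.eval z) = fun z => (Polynomial.derivative P).eval z :=
      funext fun z => P.deriv
    rw [iteratedDeriv_succ', this, ih, Function.iterate_succ_apply]

lemma differentiableOn_iteratedDeriv {U : Set ℂ} (hU : IsOpen U) {f : ℂ → ℂ}
    (hf : DifferentiableOn ℂ f U) (l : ℕ) : DifferentiableOn ℂ (iteratedDeriv l f) U := by
  induction l with
  | zero => simpa using hf
  | succ l ih =>
    rw [iteratedDeriv_succ]
    exact ih.deriv hU

lemma tendstoLocallyUniformlyOn_iteratedDeriv {ι : Type*} {φ : Filter ι} {U : Set ℂ}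
    (hU : IsOpen U) {G : ι → ℂ → ℂ} {f : ℂ → ℂ} (h : TendstoLocallyUniformlyOn G f φ U)
    (hG : ∀ n, DifferentiableOn ℂ (G n) U) (l : ℕ) :
    TendstoLocallyUniformlyOn (fun n => iteratedDeriv l (G n)) (iteratedDeriv l f) φ U := by
  induction l with
  | zero => simpa using h
  | succ l ih =>
    simp only [iteratedDeriv_succ]
    exact ih.deriv (Eventually.of_forall fun n => differentiableOn_iteratedDeriv hU (hG n) l) hU

/-- All derivatives of `f` are, finitely many at a time, uniformly approximable on `K` by those of
polynomials. -/
def PolyApprox (K : Set ℂ) (f : ℂ → ℂ) : Prop :=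
  ∀ (L : ℕ) (ε : ℝ), 0 < ε → ∃ P : ℂ[X], ∀ l ≤ L, ∀ z ∈ K,
    ‖iteratedDeriv l f z - (Polynomial.derivative^[l] P).eval z‖ < ε

namespace PolyApprox

variable {K : Set ℂ} {f g : ℂ → ℂ}

lemma of_polynomial (P : ℂ[X]) : PolyApprox K (fun z => P.eval z) := fun L ε hε =>
  ⟨P, fun l _ z _ => by rwa [iteratedDeriv_polynomial, sub_self, norm_zero]⟩

lemma add (hf : PolyApprox K f) (hg : PolyApprox K g) (hfa : AnalyticOnNhd ℂ f K)
    (hga : AnalyticOnNhd ℂ g K) : PolyApprox K (f + g) := fun L ε hε => by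
  obtain ⟨P, hP⟩ := hf L (ε / 2) (half_pos hε)
  obtain ⟨Q, hQ⟩ := hg L (ε / 2) (half_pos hε)
  refine ⟨P + Q, fun l hl z hz => ?_⟩
  rw [iteratedDeriv_add (hfa z hz).contDiffAt (hga z hz).contDiffAt,
    iterate_map_add, Polynomial.eval_add, add_sub_add_comm]
  exact (norm_add_le _ _).trans_lt (by linarith [hP l hl z hz, hQ l hl z hz])

lemma smul (hf : PolyApprox K f) (c : ℂ) : PolyApprox K (c • f) := fun L ε hε => by
  obtain ⟨P, hP⟩ := hf L (ε / (‖c‖ + 1)) (by positivity)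
  refine ⟨Polynomial.C c * P, fun l hl z hz => ?_⟩
  rw [iteratedDeriv_const_smul_field, Polynomial.iterate_derivative_C_mul, Polynomial.eval_mul,
    Polynomial.eval_C, smul_eq_mul, ← mul_sub, norm_mul]
  have h1 := hP l hl z hz
  rw [lt_div_iff₀ (by positivity)] at h1
  refine lt_of_le_of_lt ?_ h1
  rw [mul_comm]
  gcongr
  linarith

lemma deriv (hf : PolyApprox K f) : PolyApprox K (deriv f) := fun L ε hε => by
  obtain ⟨P, hP⟩ := hf (L + 1) ε hε
  refine ⟨Polynomial.derivative P, fun l hl z hz => ?_⟩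
  have := hP (l + 1) (by omega) z hz
  rwa [iteratedDeriv_succ', Function.iterate_succ_apply] at this

/-- Uniform approximation on an open neighbourhood of `K` suffices: by Weierstrass' theorem it gives
uniform convergence of every derivative on `K`. -/
lemma of_forall_exists {U : Set ℂ} (hU : IsOpen U) (hK : IsCompact K) (hKU : K ⊆ U)
    (h : ∀ ε > 0, ∃ g : ℂ → ℂ, DifferentiableOn ℂ g U ∧ PolyApprox K g ∧
      ∀ z ∈ U, ‖f z - g z‖ ≤ ε) : PolyApprox K f := fun L ε hε => by
  choose g hgU hgK hgf using fun n : ℕ => h (1 / ((n : ℝ) + 1)) Nat.one_div_pos_of_nat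
  have hu : TendstoUniformlyOn g f atTop U := by
    rw [Metric.tendstoUniformlyOn_iff]
    intro δ hδ
    filter_upwards [tendsto_one_div_add_atTop_nhds_zero_nat.eventually (gt_mem_nhds hδ)]
      with n hn z hz
    rw [dist_eq_norm]
    exact (hgf n z hz).trans_lt hn
  have hl := fun l => (tendstoLocallyUniformlyOn_iff_forall_isCompact hU).1
    (tendstoLocallyUniformlyOn_iteratedDeriv hU hu.tendstoLocallyUniformlyOn hgU l) K hKU hK
  have hev : ∀ᶠ n in atTop, ∀ l ∈ Finset.range (L + 1), ∀ z ∈ K,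
      dist (iteratedDeriv l f z) (iteratedDeriv l (g n) z) < ε / 2 :=
    (Finset.eventually_all _).2 fun l _ =>
      (Metric.tendstoUniformlyOn_iff.1 (hl l)) _ (half_pos hε)
  obtain ⟨n, hn⟩ := hev.exists
  obtain ⟨P, hP⟩ := hgK n L (ε / 2) (half_pos hε)
  refine ⟨P, fun l hl z hz => ?_⟩
  have h1 := hn l (Finset.mem_range.2 (by omega)) z hz
  have h2 := hP l hl z hz
  rw [dist_eq_norm] at h1
  exact (norm_sub_le_norm_sub_add_norm_sub _ (iteratedDeriv l (g n) z) _).trans_lt (by linarith)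

lemma of_tendstoUniformlyOn {U : Set ℂ} (hU : IsOpen U) (hK : IsCompact K) (hKU : K ⊆ U)
    {G : ℕ → ℂ → ℂ} (hGU : ∀ n, DifferentiableOn ℂ (G n) U) (hG : ∀ n, PolyApprox K (G n))
    (h : TendstoUniformlyOn G f atTop U) : PolyApprox K f :=
  of_forall_exists hU hK hKU fun ε hε => by
    obtain ⟨n, hn⟩ := ((Metric.tendstoUniformlyOn_iff.1 h) ε hε).exists
    exact ⟨G n, hGU n, hG n, fun z hz => by simpa [dist_eq_norm] using (hn z hz).le⟩

lemma sum {ι : Type*} (s : Finset ι) {G : ι → ℂ → ℂ} (hG : ∀ i ∈ s, PolyApprox K (G i))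
    (hGa : ∀ i ∈ s, AnalyticOnNhd ℂ (G i) K) : PolyApprox K (∑ i ∈ s, G i) := by
  classical
  induction s using Finset.induction_on with
  | empty => simpa [Pi.zero_def] using of_polynomial (K := K) 0
  | insert i s hi ih =>
    rw [Finset.sum_insert hi]
    refine (hG i (by simp)).add (ih (fun j hj => hG j (by simp [hj]))
      (fun j hj => hGa j (by simp [hj]))) (hGa i (by simp)) ?_
    exact Finset.analyticOnNhd_sum _ fun j hj => hGa j (by simp [hj])

end PolyApprox

lemma analyticAt_inv_sub_pow {a z : ℂ} (h : z ≠ a) (k : ℕ) :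
    AnalyticAt ℂ (fun z => ((z - a)⁻¹) ^ k) z :=
  ((analyticAt_id.sub analyticAt_const).inv (sub_ne_zero.2 h)).pow k

/-- Up to a constant, each power is the derivative of the preceding one. -/
lemma PolyApprox.inv_sub_pow {K : Set ℂ} {a : ℂ} (h : PolyApprox K fun z => (z - a)⁻¹) (k : ℕ) :
    PolyApprox K fun z => ((z - a)⁻¹) ^ k := by
  match k with
  | 0 => simpa using of_polynomial (K := K) 1
  | 1 => simpa using h
  | k + 2 =>
    have ih := ((inv_sub_pow h (k + 1)).deriv).smul (-1 / ((k : ℂ) + 1))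
    convert ih using 1
    ext z
    have hk : (k : ℂ) + 1 ≠ 0 := Nat.cast_add_one_ne_zero k
    rw [Pi.smul_apply, smul_eq_mul]
    -- At the pole itself both sides are `0` by convention, the inverse power and the derivative of
    -- a nondifferentiable function, so the identity holds on all of `ℂ`.
    by_cases hz : z = a
    · subst hz
      have hnd : ¬ DifferentiableAt ℂ (fun u => ((u - z)⁻¹) ^ (k + 1)) z := fun hd => by
        have h1 : Tendsto (fun u => ((u - z)⁻¹) ^ (k + 1) * (u - z) ^ (k + 1)) (𝓝[≠] z)
            (𝓝 (((z - z)⁻¹) ^ (k + 1) * (z - z) ^ (k + 1))) :=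
          ((hd.continuousAt.mul (by fun_prop)).tendsto).mono_left nhdsWithin_le_nhds
        have h2 : (fun u => ((u - z)⁻¹) ^ (k + 1) * (u - z) ^ (k + 1)) =ᶠ[𝓝[≠] z] fun _ => 1 := by
          filter_upwards [self_mem_nhdsWithin] with u hu
          rw [← mul_pow, inv_mul_cancel₀ (sub_ne_zero.2 hu), one_pow]
        have h3 := tendsto_nhds_unique (h1.congr' h2) tendsto_const_nhds
        simp at h3
      rw [deriv_zero_of_not_differentiableAt hnd]
      simp
    · have hza := sub_ne_zero.2 hz
      have h1 := ((((hasDerivAt_id z).sub_const a).inv hza).pow (k + 1)).deriv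
      simp only [id, Pi.inv_def, Pi.pow_def] at h1
      rw [h1]
      have h2 : -1 / (z - a) ^ 2 = -((z - a)⁻¹) ^ 2 := by rw [neg_div, one_div, inv_pow]
      rw [h2, Nat.add_sub_cancel]
      generalize (z - a)⁻¹ = u
      push_cast
      field_simp
      ring

/-- Moving a pole: approximability of `(z - a)⁻¹` passes to `(z - b)⁻¹` for `b` near `a`. -/
lemma PolyApprox.inv_sub_of_norm_lt {K : Set ℂ} (hK : IsCompact K) {a b : ℂ} {ρ : ℝ}
    (hρ : ‖b - a‖ < ρ) (hKρ : ∀ z ∈ K, ρ < ‖z - a‖) (h : PolyApprox K fun z => (z - a)⁻¹) :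
    PolyApprox K fun z => (z - b)⁻¹ := by
  have hρ0 : 0 < ρ := (norm_nonneg _).trans_lt hρ
  set U : Set ℂ := {z | ρ < ‖z - a‖}
  have hU : IsOpen U := isOpen_lt continuous_const (by fun_prop)
  have hUa : ∀ z ∈ U, z ≠ a := fun z hz h => by
    have : ρ < ‖z - a‖ := hz
    rw [h, sub_self, norm_zero] at this
    linarith
  -- Geometric expansion `(z - b)⁻¹ = ∑ (b - a) ^ n (z - a)⁻¹ ^ (n + 1)`, with ratio of norm at most
  -- `‖b - a‖ / ρ < 1`.
  have hterm : ∀ n, ∀ z ∈ U, ‖(b - a) ^ n * ((z - a)⁻¹) ^ (n + 1)‖ ≤ (‖b - a‖ / ρ) ^ n * ρ⁻¹ := by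
    intro n z hz
    have hz : ρ < ‖z - a‖ := hz
    have : ‖(z - a)⁻¹‖ ≤ ρ⁻¹ := by
      rw [norm_inv]
      exact inv_anti₀ hρ0 hz.le
    rw [norm_mul, norm_pow, norm_pow, div_pow, pow_succ, div_eq_mul_inv, mul_assoc, ← inv_pow]
    gcongr
  have hs : Summable fun n : ℕ => (‖b - a‖ / ρ) ^ n * ρ⁻¹ :=
    (summable_geometric_of_lt_one (by positivity) ((div_lt_one hρ0).2 hρ)).mul_right _
  have hlim := tendstoUniformlyOn_tsum_nat hs hterm
  have hlim' := hlim.congr_right (g := fun z => (z - b)⁻¹) fun z hz => by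
    have hza := sub_ne_zero.2 (hUa z hz)
    have hz : ρ < ‖z - a‖ := hz
    have hr : ‖(b - a) * (z - a)⁻¹‖ < 1 := by
      rw [norm_mul, norm_inv, ← div_eq_mul_inv, div_lt_one (hρ0.trans hz)]
      exact hρ.trans hz
    have hzb : z - b ≠ 0 := fun h0 => by
      rw [sub_eq_zero.1 h0] at hz
      exact lt_asymm hz hρ
    have : ∀ n : ℕ, (b - a) ^ n * ((z - a)⁻¹) ^ (n + 1) =
        ((b - a) * (z - a)⁻¹) ^ n * (z - a)⁻¹ := fun n => by
      rw [mul_pow, pow_succ, mul_assoc]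
    simp only [this]
    rw [tsum_mul_right, tsum_geometric_of_norm_lt_one hr]
    rw [← mul_inv, sub_mul, one_mul, mul_assoc, inv_mul_cancel₀ hza]
    ring_nf
  have han : ∀ (n : ℕ), ∀ z ∈ U, AnalyticAt ℂ (fun z => (b - a) ^ n * ((z - a)⁻¹) ^ (n + 1)) z :=
    fun n z hz => analyticAt_const.mul (analyticAt_inv_sub_pow (hUa z hz) _)
  refine of_tendstoUniformlyOn hU hK hKρ (fun n => ?_) (fun n => ?_) hlim'
  · exact DifferentiableOn.fun_sum fun i _ z hz =>
      (han i z hz).differentiableAt.differentiableWithinAt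
  · have := PolyApprox.sum (K := K) (Finset.range n)
      (G := fun i z => (b - a) ^ i * ((z - a)⁻¹) ^ (i + 1))
      (fun i _ => (h.inv_sub_pow (i + 1)).smul ((b - a) ^ i)) (fun i _ z hz => han i z (hKρ z hz))
    convert this using 1
    ext z
    simp

/-- A pole outside a disc containing `K`: the Taylor polynomials at `0` converge uniformly on that
disc. These are the poles from which pole pushing starts. -/
lemma PolyApprox.inv_sub_of_forall_norm_le {K : Set ℂ} (hK : IsCompact K) {a : ℂ} {ρ : ℝ}
    (hρ : ρ < ‖a‖) (hKρ : ∀ z ∈ K, ‖z‖ < ρ) : PolyApprox K fun z => (z - a)⁻¹ := by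
  rcases le_or_gt ρ 0 with hρ0 | hρ0
  · exact fun L ε _ => ⟨0, fun l _ z hz =>
      absurd ((norm_nonneg z).trans_lt (hKρ z hz)) (not_lt.2 hρ0)⟩
  have ha : a ≠ 0 := fun h => by
    rw [h, norm_zero] at hρ
    linarith
  have hterm : ∀ n, ∀ z ∈ Metric.ball (0 : ℂ) ρ, ‖-(a⁻¹) ^ (n + 1) * z ^ n‖ ≤
      ‖a‖⁻¹ * (ρ / ‖a‖) ^ n := by
    intro n z hz
    rw [mem_ball_zero_iff] at hz
    rw [norm_mul, norm_neg, norm_pow, norm_inv, norm_pow, pow_succ', mul_assoc, div_eq_inv_mul,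
      mul_pow]
    gcongr
  have hs : Summable fun n : ℕ => ‖a‖⁻¹ * (ρ / ‖a‖) ^ n :=
    (summable_geometric_of_lt_one (by positivity) ((div_lt_one (hρ0.trans hρ)).2 hρ)).mul_left _
  have hlim := (tendstoUniformlyOn_tsum_nat hs hterm).congr_right (g := fun z => (z - a)⁻¹)
    fun z hz => by
      rw [mem_ball_zero_iff] at hz
      have hr : ‖a⁻¹ * z‖ < 1 := by
        rw [norm_mul, norm_inv, ← div_eq_inv_mul, div_lt_one (hρ0.trans hρ)]
        exact hz.trans hρ
      have : ∀ n : ℕ, -(a⁻¹) ^ (n + 1) * z ^ n = -a⁻¹ * (a⁻¹ * z) ^ n := fun n => by ring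
      simp only [this]
      rw [tsum_mul_left, tsum_geometric_of_norm_lt_one hr, ← inv_neg, ← mul_inv, neg_mul, mul_sub,
        mul_one, mul_inv_cancel_left₀ ha, neg_sub]
  have hpoly : ∀ n : ℕ, (fun z => ∑ i ∈ Finset.range n, -(a⁻¹) ^ (i + 1) * z ^ i) =
      fun z => (∑ i ∈ Finset.range n,
        Polynomial.C (-(a⁻¹) ^ (i + 1)) * Polynomial.X ^ i : ℂ[X]).eval z := fun n => by
    ext z
    simp [Polynomial.eval_finsetSum]
  refine of_tendstoUniformlyOn Metric.isOpen_ball hK (fun z hz => by simpa using hKρ z hz)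
    (fun n => ?_) (fun n => ?_) hlim
  · rw [hpoly]
    exact (Polynomial.differentiable _).differentiableOn
  · rw [hpoly]
    exact of_polynomial _

/-- Runge's theorem, reduced to simple fractions. -/
lemma polyApprox_of_differentiableOn {K U : Set ℂ} (hK : IsCompact K) (hU : IsOpen U)
    (hKU : K ⊆ U) (hpole : ∀ a ∉ K, PolyApprox K fun z => (z - a)⁻¹) {f : ℂ → ℂ}
    (hf : DifferentiableOn ℂ f U) : PolyApprox K f := by
  obtain ⟨L, hL, hKL, -, φ, hφf, hφ⟩ := exists_mem_closure_simplePoleSpan hK hU hKU hf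
  have : CompactSpace L := isCompact_iff_compactSpace.1 hL
  -- The poles avoid `L` and not only `K`, so the combinations are holomorphic on `interior L`, as
  -- `of_forall_exists` requires.
  have hspan : ∀ ψ ∈ simplePoleSpan L, ∃ g : ℂ → ℂ, DifferentiableOn ℂ g (interior L) ∧
      PolyApprox K g ∧ ∀ w : L, g w = ψ w := fun ψ hψ => by
    induction hψ using Submodule.span_induction with
    | mem ψ h =>
      obtain ⟨a, ha, hψ⟩ := h
      refine ⟨(-1 : ℂ) • fun z => (z - a)⁻¹, ?_,
        (hpole a fun h => ha (interior_subset (hKL h))).smul _, fun w => ?_⟩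
      · refine DifferentiableOn.const_smul (fun z hz => ?_) _
        refine DifferentiableAt.differentiableWithinAt (.inv (by fun_prop) (sub_ne_zero.2 ?_))
        rintro rfl
        exact ha (interior_subset hz)
      · simp [hψ, ← inv_neg]
    | zero => exact ⟨fun z => (0 : ℂ[X]).eval z, by simp, .of_polynomial 0, by simp⟩
    | add ψ₁ ψ₂ _ _ h₁ h₂ =>
      obtain ⟨g₁, hd₁, hp₁, hg₁⟩ := h₁
      obtain ⟨g₂, hd₂, hp₂, hg₂⟩ := h₂
      exact ⟨g₁ + g₂, hd₁.add hd₂,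
        hp₁.add hp₂ (fun z hz => hd₁.analyticAt (isOpen_interior.mem_nhds (hKL hz)))
          (fun z hz => hd₂.analyticAt (isOpen_interior.mem_nhds (hKL hz))),
        fun w => by simp [hg₁, hg₂]⟩
    | smul c ψ _ h =>
      obtain ⟨g, hd, hp, hg⟩ := h
      exact ⟨c • g, hd.const_smul c, hp.smul c, fun w => by simp [hg]⟩
  refine .of_forall_exists isOpen_interior hK hKL fun ε hε => ?_
  obtain ⟨ψ, hψ, hd⟩ := Metric.mem_closure_iff.1 hφ ε hε
  obtain ⟨g, hgd, hgp, hgψ⟩ := hspan ψ hψ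
  refine ⟨g, hgd, hgp, fun z hz => ?_⟩
  have hz := interior_subset hz
  rw [← hφf ⟨z, hz⟩, hgψ ⟨z, hz⟩, ← dist_eq_norm]
  exact (ContinuousMap.dist_apply_le_dist _).trans hd.le

/-- Runge's theorem for the bounded parts of a closed set whose complement in the Riemann sphere is
connected. -/
lemma polyApprox_inter_closedBall {E : Set ℂ} (hE : IsClosed E)
    (hconn : IsConnected (((fun z : ℂ => (z : OnePoint ℂ)) '' E)ᶜ)) (n : ℝ) {U : Set ℂ}
    (hU : IsOpen U) (hKU : E ∩ Metric.closedBall 0 n ⊆ U) {f : ℂ → ℂ}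
    (hf : DifferentiableOn ℂ f U) : PolyApprox (E ∩ Metric.closedBall 0 n) f := by
  set K := E ∩ Metric.closedBall (0 : ℂ) n with hKdef
  have hK : IsCompact K := (isCompact_closedBall 0 n).inter_left hE
  refine polyApprox_of_differentiableOn hK hU hKU ?_ hf
  -- The admissible poles. Both `B` and its complement in `Kᶜ` are open, since a pole can be moved
  -- locally in either direction.
  set B : Set ℂ := {a | a ∉ K ∧ PolyApprox K fun z => (z - a)⁻¹} with hB
  have hbig : ∀ a : ℂ, n < ‖a‖ → a ∈ B := fun a ha => by
    obtain ⟨ρ, h1, h2⟩ := exists_between ha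
    exact ⟨fun h => absurd ha (by simpa using h.2),
      .inv_sub_of_forall_norm_le hK h2 fun z hz => lt_of_le_of_lt (by simpa using hz.2) h1⟩
  have hnear : ∀ a ∉ K, ∃ V, IsOpen V ∧ a ∈ V ∧ V ⊆ Kᶜ ∧
      ∀ b ∈ V, ∀ c ∈ V, b ∈ B → c ∈ B := fun a ha => by
    obtain ⟨δ, hδ, hδK⟩ := Metric.isOpen_iff.1 hK.isClosed.isOpen_compl a ha
    have hsub : Metric.ball a (δ / 4) ⊆ Kᶜ := (Metric.ball_subset_ball (by linarith)).trans hδK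
    -- For `b, c` within `δ / 4` of `a`, the distance from `b` to `c` is less than `δ / 2`, while
    -- points of `K` are at distance more than `δ / 2` from `b`.
    refine ⟨Metric.ball a (δ / 4), Metric.isOpen_ball, Metric.mem_ball_self (by linarith), hsub,
      fun b hb c hc hbB => ⟨hsub hc, ?_⟩⟩
    rw [Metric.mem_ball] at hb hc
    refine hbB.2.inv_sub_of_norm_lt (ρ := δ / 2) hK ?_ fun z hz => ?_
    · rw [← dist_eq_norm]
      have := dist_triangle_right c b a
      linarith
    · have h1 : δ ≤ dist z a := not_lt.1 fun h => hδK (Metric.mem_ball.2 h) hz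
      have h2 := dist_triangle z b a
      rw [← dist_eq_norm]
      linarith
  have hBo : IsOpen B := isOpen_iff_mem_nhds.2 fun a ha => by
    obtain ⟨V, hV, haV, -, h⟩ := hnear a ha.1
    exact mem_of_superset (hV.mem_nhds haV) fun c hc => h a haV c hc ha
  have hB'o : IsOpen (Kᶜ \ B) := isOpen_iff_mem_nhds.2 fun a ha => by
    obtain ⟨V, hV, haV, hVK, h⟩ := hnear a ha.1
    exact mem_of_superset (hV.mem_nhds haV) fun c hc =>
      ⟨hVK hc, fun hcB => ha.2 (h c hc a haV hcB)⟩
  -- Points of `E` outside `K` lie outside the disc and are admissible already; only the complement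
  -- of `E` needs the connectedness.
  suffices h : ∀ a ∉ E, a ∈ B by
    intro a ha
    by_cases haE : a ∈ E
    · exact (hbig a (not_le.1 fun h => ha ⟨haE, by simpa using h⟩)).2
    · exact (h a haE).2
  by_contra! hcon
  obtain ⟨a, haE, haB⟩ := hcon
  -- The complement of the compact set `u` is an open neighbourhood of `∞`. With the inadmissible
  -- poles it covers the complement of `E` in the sphere; a common point would be an inadmissible
  -- pole outside the disc.
  set u : Set (OnePoint ℂ) := (fun z : ℂ => (z : OnePoint ℂ)) '' (Metric.closedBall 0 n \ B) with hu
  have huo : IsOpen uᶜ := by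
    rw [hu, OnePoint.isOpen_compl_image_coe]
    have : Metric.closedBall (0 : ℂ) n \ B = Metric.closedBall 0 n ∩ Bᶜ := rfl
    rw [this]
    have hc := (isCompact_closedBall (0 : ℂ) n).inter_right hBo.isClosed_compl
    exact ⟨hc.isClosed, hc⟩
  have hvo : IsOpen ((fun z : ℂ => (z : OnePoint ℂ)) '' (Kᶜ \ B)) :=
    OnePoint.isOpenEmbedding_coe.isOpenMap _ hB'o
  obtain ⟨x, hx, hxu, y, hy, rfl⟩ := hconn.isPreconnected _ _ huo hvo
    (fun x hx => by
      by_cases hxu : x ∈ u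
      · obtain ⟨z, hz, rfl⟩ := hxu
        exact Or.inr ⟨z, ⟨fun hzK => hx ⟨z, hzK.1, rfl⟩, hz.2⟩, rfl⟩
      · exact Or.inl hxu)
    ⟨OnePoint.infty, by simp, by simp [hu]⟩
    ⟨a, by simpa using haE, a, ⟨fun h => haE h.1, haB⟩, rfl⟩
  refine hxu ⟨y, ⟨?_, hy.2⟩, rfl⟩
  by_contra hyn
  exact hy.2 (hbig y (by simpa using hyn))

/-! ### The topology of `A^∞(Ω)` and its completeness -/

lemma extendZero_apply {Ω : Set ℂ} (f : Ω → ℂ) (z : Ω) : extendZero f z = f z :=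
  Subtype.val_injective.extend_apply f 0 z

lemma extendZero_eventuallyEq {Ω : Set ℂ} (hΩ : IsOpen Ω) {f : Ω → ℂ} {g : ℂ → ℂ}
    (h : ∀ z : Ω, f z = g z) {z : ℂ} (hz : z ∈ Ω) : extendZero f =ᶠ[𝓝 z] g := by
  filter_upwards [hΩ.mem_nhds hz] with w hw
  exact (extendZero_apply f ⟨w, hw⟩).trans (h ⟨w, hw⟩)

namespace AInf

variable {Ω : Set ℂ}

lemma derivExt_apply (f : AInf Ω) (l : ℕ) (z : Ω) :
    f.derivExt l ⟨z.1, subset_closure z.2⟩ = iteratedDeriv l (extendZero f.1) z :=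
  (f.2.2 l).choose_spec z

lemma derivExt_eq (f : AInf Ω) (l : ℕ) (g : C(closure Ω, ℂ))
    (h : ∀ z : Ω, g ⟨z.1, subset_closure z.2⟩ = iteratedDeriv l (extendZero f.1) z) :
    f.derivExt l = g := by
  have hd : DenseRange (Set.inclusion (subset_closure : Ω ⊆ closure Ω)) :=
    (denseRange_inclusion_iff _).2 subset_rfl
  refine DFunLike.coe_injective (hd.equalizer (map_continuous _) (map_continuous _) ?_)
  ext z
  exact (f.derivExt_apply l z).trans (h z).symm

/-- If `f` is the restriction of a function `g` holomorphic near the closure of `Ω`, then the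
extended derivatives of `f` are the derivatives of `g`. -/
lemma derivExt_eq_iteratedDeriv (hΩ : IsOpen Ω) {U : Set ℂ} (hU : IsOpen U) (hΩU : closure Ω ⊆ U)
    {g : ℂ → ℂ} (hg : DifferentiableOn ℂ g U) (f : AInf Ω) (hfg : ∀ z : Ω, f.1 z = g z) (l : ℕ)
    (z : closure Ω) : f.derivExt l z = iteratedDeriv l g z := by
  have hc : Continuous fun z : closure Ω => iteratedDeriv l g z :=
    ((differentiableOn_iteratedDeriv hU hg l).continuousOn.mono hΩU).domRestrict
  rw [f.derivExt_eq l ⟨_, hc⟩ fun z =>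
    ((extendZero_eventuallyEq hΩ hfg z.2).iteratedDeriv_eq l).symm]
  rfl

/-- The restriction of a polynomial, as an element of `A^∞(Ω)`. -/
def ofPolynomial (hΩ : IsOpen Ω) (P : ℂ[X]) : AInf Ω :=
  ⟨fun z => P.eval z.1,
    P.differentiable.differentiableOn.congr fun z hz => extendZero_apply _ ⟨z, hz⟩,
    fun l => ⟨⟨fun z => (Polynomial.derivative^[l] P).eval z.1, by fun_prop⟩, fun z => by
      rw [(extendZero_eventuallyEq hΩ (g := fun w => P.eval w) (fun _ => rfl)
        z.2).iteratedDeriv_eq l, iteratedDeriv_polynomial]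
      rfl⟩⟩

lemma derivExt_of_eq_polynomial (hΩ : IsOpen Ω) {f : AInf Ω} {P : ℂ[X]}
    (h : ∀ z : Ω, f.1 z = P.eval z.1) (l : ℕ) (z : closure Ω) :
    f.derivExt l z = (Polynomial.derivative^[l] P).eval z.1 := by
  rw [f.derivExt_eq_iteratedDeriv hΩ isOpen_univ (Set.subset_univ _)
    P.differentiable.differentiableOn h, iteratedDeriv_polynomial]

lemma isInducing_derivExt : IsInducing fun f : AInf Ω => fun l : ℕ => f.derivExt l := ⟨rfl⟩

lemma continuous_derivExt (l : ℕ) : Continuous fun f : AInf Ω => f.derivExt l :=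
  (continuous_apply l).comp isInducing_derivExt.continuous

lemma tendsto_iff {ι : Type*} {p : Filter ι} {G : ι → AInf Ω} {f : AInf Ω} :
    Tendsto G p (𝓝 f) ↔ ∀ l : ℕ, ∀ K : Set (closure Ω), IsCompact K →
      TendstoUniformlyOn (fun i z => (G i).derivExt l z) (f.derivExt l) p K := by
  rw [isInducing_derivExt.tendsto_nhds_iff, tendsto_pi_nhds]
  exact forall_congr' fun l => ContinuousMap.tendsto_iff_forall_isCompact_tendstoUniformlyOn

lemma exists_nat_norm_le_of_isCompact {K : Set (closure Ω)} (hK : IsCompact K) :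
    ∃ m : ℕ, ∀ z ∈ K, ‖z.1‖ ≤ m := by
  obtain ⟨r, hr⟩ := (hK.image continuous_subtype_val).isBounded.exists_norm_le
  obtain ⟨m, hm⟩ := exists_nat_ge r
  exact ⟨m, fun z hz => (hr _ ⟨z, hz, rfl⟩).trans hm⟩

lemma isCompact_norm_le (r : ℝ) : IsCompact {z : closure Ω | ‖z.1‖ ≤ r} := by
  have h : {z : closure Ω | ‖z.1‖ ≤ r} = Subtype.val ⁻¹' Metric.closedBall (0 : ℂ) r := by
    ext z
    simp
  rw [h]
  exact isClosed_closure.isClosedEmbedding_subtypeVal.isCompact_preimage (isCompact_closedBall 0 r)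

lemma mem_closure_of_forall_exists {T : Set (AInf Ω)} {f : AInf Ω}
    (h : ∀ (n : ℕ) (ε : ℝ), 0 < ε → ∃ g ∈ T, ∀ l ≤ n, ∀ z : closure Ω, ‖z.1‖ ≤ n →
      ‖f.derivExt l z - g.derivExt l z‖ < ε) : f ∈ closure T := by
  choose g hgT hg using fun n : ℕ => h n (1 / ((n : ℝ) + 1)) Nat.one_div_pos_of_nat
  refine mem_closure_of_tendsto (f := g) (b := atTop) (tendsto_iff.2 fun l K hK => ?_)
    (Eventually.of_forall hgT)
  obtain ⟨m, hm⟩ := exists_nat_norm_le_of_isCompact hK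
  rw [Metric.tendstoUniformlyOn_iff]
  intro ε hε
  filter_upwards [tendsto_one_div_add_atTop_nhds_zero_nat.eventually (gt_mem_nhds hε),
    eventually_ge_atTop l, eventually_ge_atTop m] with n hn hln hmn z hz
  rw [dist_eq_norm]
  exact (hg n l hln z ((hm z hz).trans (by exact_mod_cast hmn))).trans hn

/-- The ambient product is metrizable, so sequences suffice. Locally uniform convergence on `Ω`
forces the limits of the derivatives to be the derivatives of the limit. -/
lemma isClosed_range_derivExt (hΩ : IsOpen Ω) :
    IsClosed (Set.range fun f : AInf Ω => fun l : ℕ => f.derivExt l) := by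
  have : LocallyCompactSpace (closure Ω) := isClosed_closure.locallyCompactSpace
  have : SigmaCompactSpace (closure Ω) :=
    isClosed_closure.isClosedEmbedding_subtypeVal.sigmaCompactSpace
  refine isClosed_of_closure_subset fun g hg => ?_
  obtain ⟨u, hu, hug⟩ := mem_closure_iff_seq_limit.1 hg
  choose F hF using hu
  have hlim : ∀ l K, IsCompact K →
      TendstoUniformlyOn (fun n z => (F n).derivExt l z) (g l) atTop K := fun l K hK => by
    have h1 := (tendsto_pi_nhds.1 hug) l
    rw [ContinuousMap.tendsto_iff_forall_isCompact_tendstoUniformlyOn] at h1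
    simpa only [← hF] using h1 K hK
  set f : Ω → ℂ := fun z => g 0 ⟨z.1, subset_closure z.2⟩ with hf
  have hloc : TendstoLocallyUniformlyOn (fun n => extendZero (F n).1) (extendZero f) atTop Ω := by
    rw [tendstoLocallyUniformlyOn_iff_forall_isCompact hΩ]
    intro K hKΩ hK
    have hK' : IsCompact (Subtype.val ⁻¹' K : Set (closure Ω)) :=
      isClosed_closure.isClosedEmbedding_subtypeVal.isCompact_preimage hK
    have h1 := hlim 0 _ hK'
    rw [Metric.tendstoUniformlyOn_iff] at h1 ⊢
    intro ε hε
    filter_upwards [h1 ε hε] with n hn z hz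
    have h2 := hn ⟨z, subset_closure (hKΩ hz)⟩ hz
    rw [(F n).derivExt_apply 0 ⟨z, hKΩ hz⟩, iteratedDeriv_zero] at h2
    rwa [extendZero_apply f ⟨z, hKΩ hz⟩]
  have hd : DifferentiableOn ℂ (extendZero f) Ω :=
    hloc.differentiableOn (Eventually.of_forall fun n => (F n).2.1) hΩ
  have hder : ∀ l, ∀ z : Ω, g l ⟨z.1, subset_closure z.2⟩ = iteratedDeriv l (extendZero f) z :=
    fun l z => by
      have h1 := (tendstoLocallyUniformlyOn_iteratedDeriv hΩ hloc (fun n => (F n).2.1) l).tendsto_at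
        z.2
      have h2 := (hlim l {⟨z.1, subset_closure z.2⟩} isCompact_singleton).tendsto_at rfl
      simp only [derivExt_apply] at h2
      exact tendsto_nhds_unique h2 h1
  exact ⟨⟨f, hd, fun l => ⟨g l, hder l⟩⟩, funext fun l => derivExt_eq _ l (g l) (hder l)⟩

lemma injective_derivExt : Function.Injective fun f : AInf Ω => fun l : ℕ => f.derivExt l := by
  intro f g h
  refine Subtype.ext (funext fun z => ?_)
  have h0 := congrArg (fun φ : C(closure Ω, ℂ) => φ ⟨z.1, subset_closure z.2⟩) (congrFun h 0)
  simpa only [derivExt_apply, iteratedDeriv_zero, extendZero_apply] using h0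

lemma isCompletelyPseudoMetrizableSpace (hΩ : IsOpen Ω) :
    TopologicalSpace.IsCompletelyPseudoMetrizableSpace (AInf Ω) := by
  have : LocallyCompactSpace (closure Ω) := isClosed_closure.locallyCompactSpace
  have : SigmaCompactSpace (closure Ω) :=
    isClosed_closure.isClosedEmbedding_subtypeVal.sigmaCompactSpace
  have h : IsClosedEmbedding fun f : AInf Ω => fun l : ℕ => f.derivExt l :=
    ⟨⟨isInducing_derivExt, injective_derivExt⟩, isClosed_range_derivExt hΩ⟩
  exact h.IsCompletelyPseudoMetrizableSpace

/-- Baire's theorem for the closed subsets of `A^∞(Ω)`. -/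
lemma baireSpace_of_isClosed (hΩ : IsOpen Ω) {T : Set (AInf Ω)} (hT : IsClosed T) :
    BaireSpace T := by
  have := isCompletelyPseudoMetrizableSpace hΩ
  have := hT.isCompletelyPseudoMetrizableSpace
  infer_instance

end AInf

/-! ### Density of the polynomials in `X^∞` -/

lemma polynomialRestrictions_subset_holoNearClosure (Ω : Set ℂ) :
    polynomialRestrictions Ω ⊆ holoNearClosure Ω := fun _ ⟨P, hP⟩ =>
  ⟨Set.univ, isOpen_univ, Set.subset_univ _, fun z => P.eval z, P.differentiable.differentiableOn,
    hP⟩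

/-- A function in `A^∞(Ω)` which can be approximated by functions holomorphic near the bounded parts
of the closure of `Ω` can be approximated by polynomials. -/
lemma mem_closure_polynomialRestrictions {Ω : Set ℂ} (hΩ : IsOpen Ω)
    (hconn : IsConnected (((fun z : ℂ => (z : OnePoint ℂ)) '' closure Ω)ᶜ)) {f : AInf Ω}
    (h : ∀ (n : ℕ) (ε : ℝ), 0 < ε → ∃ (U : Set ℂ) (g : ℂ → ℂ), IsOpen U ∧
      closure Ω ∩ Metric.closedBall 0 n ⊆ U ∧ DifferentiableOn ℂ g U ∧
      ∀ l ≤ n, ∀ z : closure Ω, ‖z.1‖ ≤ n → ‖f.derivExt l z - iteratedDeriv l g z‖ < ε) :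
    f ∈ closure (polynomialRestrictions Ω) := by
  refine AInf.mem_closure_of_forall_exists fun n ε hε => ?_
  obtain ⟨U, g, hU, hKU, hg, hfg⟩ := h n (ε / 2) (half_pos hε)
  obtain ⟨P, hP⟩ := polyApprox_inter_closedBall isClosed_closure hconn n hU hKU hg n (ε / 2)
    (half_pos hε)
  refine ⟨AInf.ofPolynomial hΩ P, ⟨P, fun _ => rfl⟩, fun l hl z hz => ?_⟩
  rw [AInf.derivExt_of_eq_polynomial hΩ (f := AInf.ofPolynomial hΩ P) (P := P) (fun _ => rfl)]
  have h1 := hfg l hl z hz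
  have h2 := hP l hl z ⟨z.2, by simpa using hz⟩
  exact (norm_sub_le_norm_sub_add_norm_sub _ (iteratedDeriv l g z) _).trans_lt (by linarith)

lemma XInf_eq_closure_polynomialRestrictions {Ω : Set ℂ} (hΩ : IsOpen Ω)
    (hconn : IsConnected (((fun z : ℂ => (z : OnePoint ℂ)) '' closure Ω)ᶜ)) :
    XInf Ω = closure (polynomialRestrictions Ω) := by
  refine (closure_minimal ?_ isClosed_closure).antisymm
    (closure_mono (polynomialRestrictions_subset_holoNearClosure Ω))
  rintro f ⟨U, hU, hΩU, g, hg, hfg⟩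
  refine mem_closure_polynomialRestrictions hΩ hconn fun n ε hε =>
    ⟨U, g, hU, Set.inter_subset_left.trans hΩU, hg, fun l _ z _ => ?_⟩
  rwa [AInf.derivExt_eq_iteratedDeriv hΩ hU hΩU hg f hfg, sub_self, norm_zero]

/-! ### Padé approximants: uniqueness and determinant formulas -/

lemma PowerSeries.coeff_mul_eq_of_coeff_eq {R : Type*} [CommSemiring R] {A B : R⟦X⟧} {m : ℕ}
    (h : ∀ v ≤ m, PowerSeries.coeff v A = PowerSeries.coeff v B) (C : R⟦X⟧) :
    ∀ v ≤ m, PowerSeries.coeff v (A * C) = PowerSeries.coeff v (B * C) := fun v hv => by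
  rw [PowerSeries.coeff_mul, PowerSeries.coeff_mul]
  refine Finset.sum_congr rfl fun x hx => ?_
  rw [h x.1 (by have := Finset.HasAntidiagonal.mem_antidiagonal.1 hx; omega)]

/-- The numerator and the denominator of a `[p/q]` Padé approximant of `∑ a_v t^v`, the latter
normalized by `D(0) = 1`. -/
structure IsPadePair (a : ℕ → ℂ) (p q : ℕ) (N D : ℂ[X]) : Prop where
  natDegree_num_le : N.natDegree ≤ p
  natDegree_denom_le : D.natDegree ≤ q
  coeff_denom_zero : D.coeff 0 = 1
  coeff_eq : ∀ v ≤ p + q,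
    PowerSeries.coeff v (N : ℂ⟦X⟧) = PowerSeries.coeff v ((D : ℂ⟦X⟧) * PowerSeries.mk a)

lemma coe_mul_inv_cancel {D : ℂ[X]} (h : D.coeff 0 ≠ 0) : (D : ℂ⟦X⟧) * (D : ℂ⟦X⟧)⁻¹ = 1 :=
  PowerSeries.mul_inv_cancel _ (by simpa using h)

/-- Since `D(0) = 1`, the denominator is a unit among power series and can be cleared reversibly;
the conditions become linear in the coefficients of `N` and `D`. -/
lemma isPade_iff {a : ℕ → ℂ} {p q : ℕ} {R : RatFunc ℂ} :
    IsPade a p q R ↔ ∃ N D : ℂ[X], IsPadePair a p q N D ∧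
      R = algebraMap ℂ[X] (RatFunc ℂ) N / algebraMap ℂ[X] (RatFunc ℂ) D := by
  constructor
  · rintro ⟨N, D, hN, hD, hD0, hR, h⟩
    refine ⟨N, D, ⟨hN, hD, hD0, ?_⟩, hR⟩
    have h1 : ∀ v ≤ p + q, PowerSeries.coeff v ((N : ℂ⟦X⟧) * (D : ℂ⟦X⟧)⁻¹) =
        PowerSeries.coeff v (PowerSeries.mk a) := fun v hv => by
      rw [h v hv, PowerSeries.coeff_mk]
    have h2 := PowerSeries.coeff_mul_eq_of_coeff_eq h1 (D : ℂ⟦X⟧)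
    have h3 : (N : ℂ⟦X⟧) * (D : ℂ⟦X⟧)⁻¹ * D = N := by
      rw [mul_assoc, mul_comm _ (D : ℂ⟦X⟧), coe_mul_inv_cancel (by simp [hD0]), mul_one]
    rwa [h3, mul_comm (PowerSeries.mk a)] at h2
  · rintro ⟨N, D, h, hR⟩
    refine ⟨N, D, h.1, h.2, h.3, hR, fun v hv => ?_⟩
    have h2 := PowerSeries.coeff_mul_eq_of_coeff_eq h.4 (D : ℂ⟦X⟧)⁻¹ v hv
    rw [h2, mul_right_comm, coe_mul_inv_cancel (by simp [h.3]), one_mul, PowerSeries.coeff_mk]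

lemma coeff_coe_mul_mk {a : ℕ → ℂ} {q : ℕ} {D : ℂ[X]} (hD : D.natDegree ≤ q) (v : ℕ) :
    PowerSeries.coeff v ((D : ℂ⟦X⟧) * PowerSeries.mk a) =
      D.coeff 0 * a v + ∑ j : Fin q, coeffInt a ((v : ℤ) - q + (j : ℕ)) * D.coeff (q - j) := by
  have h1 : PowerSeries.coeff v ((D : ℂ⟦X⟧) * PowerSeries.mk a) =
      ∑ k ∈ Finset.range (v + 1), D.coeff k * coeffInt a ((v : ℤ) - k) := by
    rw [PowerSeries.coeff_mul, Finset.Nat.sum_antidiagonal_eq_sum_range_succ_mk]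
    refine Finset.sum_congr rfl fun k hk => ?_
    have hk : k ≤ v := Nat.lt_succ_iff.1 (Finset.mem_range.1 hk)
    have h2 : ((v : ℤ) - k) = ((v - k : ℕ) : ℤ) := by omega
    rw [Polynomial.coeff_coe, PowerSeries.coeff_mk, coeffInt, h2]
    simp
  -- Padding by zeros, from `a` at negative indices here and from `D` beyond degree `q` in `h3`,
  -- makes the two ranges agree.
  have h2 : ∀ m, ∑ k ∈ Finset.range (v + 1), D.coeff k * coeffInt a ((v : ℤ) - k) =
      ∑ k ∈ Finset.range (v + 1 + m), D.coeff k * coeffInt a ((v : ℤ) - k) := fun m => by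
    refine Finset.sum_subset (Finset.range_mono (by omega)) fun k _ hk => ?_
    rw [Finset.mem_range] at hk
    rw [coeffInt, if_pos (by omega), mul_zero]
  have h3 : ∀ m, ∑ k ∈ Finset.range (q + 1), D.coeff k * coeffInt a ((v : ℤ) - k) =
      ∑ k ∈ Finset.range (q + 1 + m), D.coeff k * coeffInt a ((v : ℤ) - k) := fun m => by
    refine Finset.sum_subset (Finset.range_mono (by omega)) fun k _ hk => ?_
    rw [Finset.mem_range] at hk
    rw [Polynomial.coeff_eq_zero_of_natDegree_lt (by omega), zero_mul]
  rw [h1, h2 q, show v + 1 + q = q + 1 + v by omega, ← h3 v, Finset.sum_range_succ', add_comm]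
  have hz : coeffInt a ((v : ℤ) - (0 : ℕ)) = a v := by simp [coeffInt]
  rw [hz]
  congr 1
  rw [← Finset.sum_range_reflect, Finset.sum_fin_eq_sum_range]
  refine Finset.sum_congr rfl fun j hj => ?_
  have hj := Finset.mem_range.1 hj
  rw [dif_pos hj, mul_comm]
  have e1 : q - 1 - j + 1 = q - j := by omega
  rw [e1]
  congr 2
  push_cast [Nat.cast_sub hj.le]
  ring

/-- In the orders `p + 1, …, p + q`, where the numerator must vanish, the conditions form a Hankel
system for the coefficients of `D` in reversed order. -/
lemma coeff_coe_mul_mk_eq_mulVec {a : ℕ → ℂ} {p q : ℕ} {D : ℂ[X]} (hD : D.natDegree ≤ q)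
    (i : Fin q) :
    PowerSeries.coeff (p + 1 + i) ((D : ℂ⟦X⟧) * PowerSeries.mk a) =
      D.coeff 0 * a (p + 1 + i) + (hankel a p q).mulVec (fun j => D.coeff (q - j)) i := by
  rw [coeff_coe_mul_mk hD]
  congr 1
  refine Finset.sum_congr rfl fun j _ => ?_
  simp only [hankel, Matrix.of_apply]
  congr 2
  push_cast
  ring

namespace IsPadePair

variable {a : ℕ → ℂ} {p q : ℕ} {N D : ℂ[X]}

lemma mulVec_eq (h : IsPadePair a p q N D) :
    (hankel a p q).mulVec (fun j => D.coeff (q - j)) = fun i : Fin q => -a (p + 1 + i) := by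
  ext i
  have h1 := h.coeff_eq (p + 1 + i) (by omega)
  rw [coeff_coe_mul_mk_eq_mulVec h.natDegree_denom_le, Polynomial.coeff_coe,
    Polynomial.coeff_eq_zero_of_natDegree_lt (by have := h.natDegree_num_le; omega),
    h.coeff_denom_zero, one_mul] at h1
  exact eq_neg_of_add_eq_zero_right h1.symm

/-- The invertible Hankel system determines `D`, and then the coefficient equations determine `N`.
-/
lemma unique (hD : InD a p q) (h : IsPadePair a p q N D) {N' D' : ℂ[X]}
    (h' : IsPadePair a p q N' D') : N = N' ∧ D = D' := by
  have hx : (fun j : Fin q => D.coeff (q - j)) = fun j : Fin q => D'.coeff (q - j) := by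
    have hu : IsUnit (hankel a p q) := (Matrix.isUnit_iff_isUnit_det _).2 (isUnit_iff_ne_zero.2 hD)
    exact Matrix.mulVec_injective_iff_isUnit.2 hu (h.mulVec_eq.trans h'.mulVec_eq.symm)
  have hDD : D = D' := by
    ext k
    rcases Nat.eq_zero_or_pos k with rfl | hk
    · rw [h.coeff_denom_zero, h'.coeff_denom_zero]
    by_cases hkq : k ≤ q
    · have := congrFun hx ⟨q - k, by omega⟩
      simpa [Nat.sub_sub_self hkq] using this
    · rw [Polynomial.coeff_eq_zero_of_natDegree_lt, Polynomial.coeff_eq_zero_of_natDegree_lt]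
      · have := h'.natDegree_denom_le
        omega
      · have := h.natDegree_denom_le
        omega
  refine ⟨?_, hDD⟩
  subst hDD
  ext v
  by_cases hv : v ≤ p + q
  · have h1 := h.coeff_eq v hv
    rwa [← h'.coeff_eq v hv, Polynomial.coeff_coe, Polynomial.coeff_coe] at h1
  · rw [Polynomial.coeff_eq_zero_of_natDegree_lt, Polynomial.coeff_eq_zero_of_natDegree_lt]
    · have := h'.natDegree_num_le
      omega
    · have := h.natDegree_num_le
      omega

/-- A factor cancelled in reducing `R` does not vanish at `0`, so it is a unit among power series,
and the reduced fraction, rescaled, is again a Padé pair; uniqueness identifies it with `(N, D)`.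
Hence the poles of `R` are exactly the zeros of `D`. -/
lemma num_denom (hD : InD a p q) (h : IsPadePair a p q N D) {R : RatFunc ℂ}
    (hR : IsPade a p q R) :
    ∃ c : ℂ, c ≠ 0 ∧ R.num = Polynomial.C c * N ∧ R.denom = Polynomial.C c * D := by
  obtain ⟨N₀, D₀, h₀, hR⟩ := isPade_iff.1 hR
  have hD₀ : D₀ ≠ 0 := by
    rintro rfl
    simpa using h₀.coeff_denom_zero
  have hden : R.denom ≠ 0 := R.denom_ne_zero
  obtain ⟨g, hg⟩ : R.denom ∣ D₀ := hR ▸ RatFunc.denom_div_dvd _ _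
  have hN₀ : N₀ = R.num * g := by
    have h1 := RatFunc.num_div_denom R
    have i1 : algebraMap ℂ[X] (RatFunc ℂ) D₀ ≠ 0 := RatFunc.algebraMap_ne_zero hD₀
    have i2 : algebraMap ℂ[X] (RatFunc ℂ) R.denom ≠ 0 := RatFunc.algebraMap_ne_zero hden
    have h2 := h1.trans hR
    rw [div_eq_div_iff i2 i1, ← map_mul, ← map_mul] at h2
    have h3 := RatFunc.algebraMap_injective ℂ h2
    refine mul_right_cancel₀ hden (h3.symm.trans ?_)
    rw [hg]
    ring
  have hc0 : R.denom.coeff 0 * g.coeff 0 = 1 := by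
    rw [← Polynomial.mul_coeff_zero, ← hg, h₀.coeff_denom_zero]
  have hc : R.denom.coeff 0 ≠ 0 := left_ne_zero_of_mul_eq_one hc0
  have hg0 : g.coeff 0 ≠ 0 := right_ne_zero_of_mul_eq_one hc0
  have hg' : g ≠ 0 := by
    rintro rfl
    simp at hg0
  set c := R.denom.coeff 0 with hcdef
  have hpair : IsPadePair a p q (Polynomial.C c⁻¹ * R.num) (Polynomial.C c⁻¹ * R.denom) := by
    refine ⟨(Polynomial.natDegree_C_mul_le _ _).trans ?_,
      (Polynomial.natDegree_C_mul_le _ _).trans ?_, ?_, ?_⟩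
    · by_cases hn : R.num = 0
      · simp [hn]
      · have := h₀.natDegree_num_le
        rw [hN₀, Polynomial.natDegree_mul hn hg'] at this
        omega
    · have := h₀.natDegree_denom_le
      rw [hg, Polynomial.natDegree_mul hden hg'] at this
      omega
    · rw [Polynomial.coeff_C_mul, ← hcdef, inv_mul_cancel₀ hc]
    · have h1 := PowerSeries.coeff_mul_eq_of_coeff_eq h₀.coeff_eq
        ((Polynomial.C c⁻¹ : ℂ[X]) * (g : ℂ⟦X⟧)⁻¹)
      intro v hv
      convert h1 v hv using 2
      · rw [hN₀, Polynomial.coe_mul, Polynomial.coe_mul]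
        linear_combination -((Polynomial.C c⁻¹ : ℂ[X]) : ℂ⟦X⟧) * R.num * coe_mul_inv_cancel hg0
      · rw [hg, Polynomial.coe_mul, Polynomial.coe_mul]
        linear_combination -((Polynomial.C c⁻¹ : ℂ[X]) : ℂ⟦X⟧) * R.denom * PowerSeries.mk a *
          coe_mul_inv_cancel hg0
  obtain ⟨e1, e2⟩ := h.unique hD hpair
  have hcc : Polynomial.C c * Polynomial.C c⁻¹ = 1 := by
    rw [← Polynomial.C_mul, mul_inv_cancel₀ hc, Polynomial.C_1]
  exact ⟨c, hc, by rw [e1, ← mul_assoc, hcc, one_mul], by rw [e2, ← mul_assoc, hcc, one_mul]⟩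

lemma ratValue_eq (hD : InD a p q) (h : IsPadePair a p q N D) {R : RatFunc ℂ}
    (hR : IsPade a p q R) (ζ z : ℂ) : ratValue R ζ z = N.eval (z - ζ) / D.eval (z - ζ) := by
  obtain ⟨c, hc, h1, h2⟩ := h.num_denom hD hR
  rw [ratValue, h1, h2, Polynomial.eval_mul, Polynomial.eval_mul, Polynomial.eval_C,
    mul_div_mul_left _ _ hc]

lemma hasPole_iff (hD : InD a p q) (h : IsPadePair a p q N D) {R : RatFunc ℂ}
    (hR : IsPade a p q R) (ζ z : ℂ) : HasPole R ζ z ↔ D.eval (z - ζ) = 0 := by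
  obtain ⟨c, hc, h1, h2⟩ := h.num_denom hD hR
  rw [HasPole, h2, Polynomial.eval_mul, Polynomial.eval_C, mul_eq_zero, or_iff_right hc]

end IsPadePair

/-- The coefficients of the denominator of the Padé approximant, multiplied by the Hankel
determinant. -/
def padeDenomCoeff (a : ℕ → ℂ) (p q k : ℕ) : ℂ :=
  -- Cramer's rule with the adjugate in place of the inverse keeps the coefficients polynomial in
  -- `a`, hence continuous even where the determinant vanishes. Of the other case `padeDenom` uses
  -- only `k = 0`.
  if h : 0 < k ∧ k ≤ q then
    -(hankel a p q).adjugate.mulVec (fun i => a (p + 1 + i)) ⟨q - k, by omega⟩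
  else (hankel a p q).det

/-- The denominator of the Padé approximant, multiplied by the Hankel determinant. -/
def padeDenom (a : ℕ → ℂ) (p q : ℕ) : ℂ[X] :=
  ∑ k ∈ Finset.range (q + 1), Polynomial.C (padeDenomCoeff a p q k) * Polynomial.X ^ k

/-- The numerator of the Padé approximant, multiplied by the Hankel determinant. -/
def padeNum (a : ℕ → ℂ) (p q : ℕ) : ℂ[X] :=
  ∑ v ∈ Finset.range (p + 1),
    Polynomial.C (PowerSeries.coeff v ((padeDenom a p q : ℂ⟦X⟧) * PowerSeries.mk a)) *
      Polynomial.X ^ v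

lemma coeff_sum_range_C_mul_X_pow (c : ℕ → ℂ) (n k : ℕ) :
    (∑ i ∈ Finset.range n, Polynomial.C (c i) * Polynomial.X ^ i).coeff k =
      if k < n then c k else 0 := by
  simp [Polynomial.finsetSum_coeff, Polynomial.coeff_X_pow]

lemma natDegree_sum_range_C_mul_X_pow_le (c : ℕ → ℂ) (n : ℕ) :
    (∑ i ∈ Finset.range (n + 1), Polynomial.C (c i) * Polynomial.X ^ i).natDegree ≤ n :=
  Polynomial.natDegree_le_iff_coeff_eq_zero.2 fun k hk => by
    rw [coeff_sum_range_C_mul_X_pow, if_neg (by omega)]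

lemma natDegree_padeDenom_le (a : ℕ → ℂ) (p q : ℕ) : (padeDenom a p q).natDegree ≤ q :=
  natDegree_sum_range_C_mul_X_pow_le _ _

lemma natDegree_padeNum_le (a : ℕ → ℂ) (p q : ℕ) : (padeNum a p q).natDegree ≤ p :=
  natDegree_sum_range_C_mul_X_pow_le _ _

lemma coeff_padeDenom_zero (a : ℕ → ℂ) (p q : ℕ) :
    (padeDenom a p q).coeff 0 = (hankel a p q).det := by
  rw [padeDenom, coeff_sum_range_C_mul_X_pow, if_pos (Nat.succ_pos q), padeDenomCoeff,
    dif_neg (by omega)]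

/-- Beyond order `p` the right side is `det H • b - H (adj H) b = 0`, whether or not `det H`
vanishes. -/
lemma coeff_padeNum (a : ℕ → ℂ) (p q : ℕ) {v : ℕ} (hv : v ≤ p + q) :
    (padeNum a p q).coeff v =
      PowerSeries.coeff v ((padeDenom a p q : ℂ⟦X⟧) * PowerSeries.mk a) := by
  rw [padeNum, coeff_sum_range_C_mul_X_pow]
  split_ifs with hvp
  · rfl
  obtain ⟨i, rfl⟩ : ∃ i : Fin q, v = p + 1 + i := ⟨⟨v - (p + 1), by omega⟩, by simp; omega⟩
  rw [coeff_coe_mul_mk_eq_mulVec (natDegree_padeDenom_le a p q), coeff_padeDenom_zero]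
  have hx : (fun j : Fin q => (padeDenom a p q).coeff (q - j)) =
      -(hankel a p q).adjugate.mulVec (fun i => a (p + 1 + i)) := by
    ext j
    rw [padeDenom, coeff_sum_range_C_mul_X_pow, if_pos (by omega), padeDenomCoeff,
      dif_pos (by omega), Pi.neg_apply]
    congr 2
    ext
    simp
    omega
  rw [hx, Matrix.mulVec_neg, Matrix.mulVec_mulVec, Matrix.mul_adjugate]
  simp [Matrix.smul_mulVec]

lemma isPadePair_padeNum_padeDenom {a : ℕ → ℂ} {p q : ℕ} (hD : InD a p q) :
    IsPadePair a p q (Polynomial.C (hankel a p q).det⁻¹ * padeNum a p q)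
      (Polynomial.C (hankel a p q).det⁻¹ * padeDenom a p q) where
  natDegree_num_le := (Polynomial.natDegree_C_mul_le _ _).trans (natDegree_padeNum_le a p q)
  natDegree_denom_le := (Polynomial.natDegree_C_mul_le _ _).trans (natDegree_padeDenom_le a p q)
  coeff_denom_zero := by
    rw [Polynomial.coeff_C_mul, coeff_padeDenom_zero, inv_mul_cancel₀ hD]
  coeff_eq v hv := by
    rw [Polynomial.coe_mul, Polynomial.coe_mul, Polynomial.coe_C, mul_assoc,
      PowerSeries.coeff_C_mul, PowerSeries.coeff_C_mul, ← coeff_padeNum a p q hv,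
      Polynomial.coeff_coe]

lemma exists_isPade {a : ℕ → ℂ} {p q : ℕ} (hD : InD a p q) : ∃ R, IsPade a p q R :=
  ⟨_, isPade_iff.2 ⟨_, _, isPadePair_padeNum_padeDenom hD, rfl⟩⟩

section Values

variable {a : ℕ → ℂ} {p q : ℕ} {R : RatFunc ℂ}

lemma ratValue_eq_padeNum_div_padeDenom (hD : InD a p q) (hR : IsPade a p q R) (ζ z : ℂ) :
    ratValue R ζ z = (padeNum a p q).eval (z - ζ) / (padeDenom a p q).eval (z - ζ) := by
  rw [(isPadePair_padeNum_padeDenom hD).ratValue_eq hD hR, Polynomial.eval_mul, Polynomial.eval_mul,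
    Polynomial.eval_C, mul_div_mul_left _ _ (inv_ne_zero hD)]

lemma hasPole_iff_eval_padeDenom (hD : InD a p q) (hR : IsPade a p q R) (ζ z : ℂ) :
    HasPole R ζ z ↔ (padeDenom a p q).eval (z - ζ) = 0 := by
  rw [(isPadePair_padeNum_padeDenom hD).hasPole_iff hD hR, Polynomial.eval_mul, Polynomial.eval_C,
    mul_eq_zero, or_iff_right (inv_ne_zero hD)]

end Values

/-- For a polynomial of degree `p` the Hankel determinants of the order `p` do not vanish. -/
lemma inD_of_polynomial {a : ℕ → ℂ} {p : ℕ} (ha : a p ≠ 0) (h0 : ∀ v, p < v → a v = 0) (q : ℕ) :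
    InD a p q := by
  -- With its columns reversed, the Hankel matrix has entries `a_{p + i - j}`: it is upper
  -- triangular with `a p` on the diagonal.
  have htri : ((hankel a p q).submatrix id Fin.revPerm).BlockTriangular id := fun i j hij => by
    have hij : j < i := hij
    simp only [hankel, Matrix.submatrix_apply, Matrix.of_apply, id, Fin.revPerm_apply, Fin.val_rev]
    have h1 : (p : ℤ) - q + 1 + (i : ℕ) + ((q - (j + 1) : ℕ) : ℤ) = ((p + (i - j) : ℕ) : ℤ) := by
      have := j.2
      omega
    rw [h1, coeffInt, if_neg (by omega), Int.toNat_natCast]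
    exact h0 _ (by omega)
  have hdet := Matrix.det_of_isUpperTriangular htri
  rw [Matrix.det_permute'] at hdet
  have hdiag : ∀ i, (hankel a p q).submatrix id Fin.revPerm i i = a p := fun i => by
    simp only [hankel, Matrix.submatrix_apply, Matrix.of_apply, id, Fin.revPerm_apply, Fin.val_rev]
    have h1 : (p : ℤ) - q + 1 + (i : ℕ) + ((q - (i + 1) : ℕ) : ℤ) = (p : ℤ) := by
      have := i.2
      omega
    rw [h1, coeffInt, if_neg (by omega), Int.toNat_natCast]
  intro h
  rw [h, mul_zero] at hdet
  refine Finset.prod_ne_zero_iff.2 (fun i _ => ?_) hdet.symm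
  rw [hdiag]
  exact ha

lemma isPadePair_of_polynomial {a : ℕ → ℂ} {p : ℕ} (q : ℕ) {Q : ℂ[X]} (hQ : Q.natDegree ≤ p)
    (ha : ∀ v, a v = Q.coeff v) : IsPadePair a p q Q 1 where
  natDegree_num_le := hQ
  natDegree_denom_le := by simp
  coeff_denom_zero := by simp
  coeff_eq v _ := by simp [ha]

/-! ### Derivatives of quotients and continuous dependence -/

/-- The numerator of the `l`-th derivative of `N / D`, the denominator being `D ^ (l + 1)`. -/
def derivNum (N D : ℂ[X]) : ℕ → ℂ[X]
  | 0 => N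
  | l + 1 => Polynomial.derivative (derivNum N D l) * D -
      Polynomial.C ((l : ℂ) + 1) * (derivNum N D l * Polynomial.derivative D)

lemma iteratedDeriv_div (N D : ℂ[X]) (ζ : ℂ) (l : ℕ) {z : ℂ} (hz : D.eval (z - ζ) ≠ 0) :
    iteratedDeriv l (fun z => N.eval (z - ζ) / D.eval (z - ζ)) z =
      (derivNum N D l).eval (z - ζ) / D.eval (z - ζ) ^ (l + 1) := by
  induction l generalizing z with
  | zero => simp [derivNum]
  | succ l ih =>
    have hopen : IsOpen {z : ℂ | D.eval (z - ζ) ≠ 0} := isOpen_ne_fun (by fun_prop) (by fun_prop)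
    have hev : iteratedDeriv l (fun z => N.eval (z - ζ) / D.eval (z - ζ)) =ᶠ[𝓝 z] fun z =>
        (derivNum N D l).eval (z - ζ) / D.eval (z - ζ) ^ (l + 1) := by
      filter_upwards [hopen.mem_nhds hz] with w hw using ih hw
    have hP : ∀ P : ℂ[X], HasDerivAt (fun z => P.eval (z - ζ))
        ((Polynomial.derivative P).eval (z - ζ)) z := fun P =>
      (P.hasDerivAt (z - ζ)).comp_sub_const z ζ
    have h1 := (hP (derivNum N D l)).div ((hP D).pow (l + 1)) (pow_ne_zero _ hz)
    rw [iteratedDeriv_succ, hev.deriv_eq]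
    refine h1.deriv.trans ?_
    simp only [derivNum, Polynomial.eval_sub, Polynomial.eval_mul, Polynomial.eval_C,
      Nat.add_sub_cancel, Pi.pow_apply]
    rw [div_eq_div_iff (pow_ne_zero _ (pow_ne_zero _ hz)) (pow_ne_zero _ hz)]
    push_cast
    ring

/-- A family of polynomials of bounded degree with continuous coefficients. -/
structure ContinuousFamily {X : Type*} [TopologicalSpace X] (P : X → ℂ[X]) : Prop where
  continuous_coeff : ∀ k, Continuous fun x => (P x).coeff k
  exists_natDegree_le : ∃ d, ∀ x, (P x).natDegree ≤ d

namespace ContinuousFamily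

variable {X : Type*} [TopologicalSpace X] {P Q : X → ℂ[X]}

lemma mul (hP : ContinuousFamily P) (hQ : ContinuousFamily Q) :
    ContinuousFamily fun x => P x * Q x where
  continuous_coeff k := by
    simp only [Polynomial.coeff_mul]
    exact continuous_finsetSum _ fun i _ =>
      (hP.continuous_coeff i.1).mul (hQ.continuous_coeff i.2)
  exists_natDegree_le := by
    obtain ⟨d, hd⟩ := hP.exists_natDegree_le
    obtain ⟨e, he⟩ := hQ.exists_natDegree_le
    exact ⟨d + e, fun x => Polynomial.natDegree_mul_le_of_le (hd x) (he x)⟩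

lemma sub (hP : ContinuousFamily P) (hQ : ContinuousFamily Q) :
    ContinuousFamily fun x => P x - Q x where
  continuous_coeff k := by
    simp only [Polynomial.coeff_sub]
    exact (hP.continuous_coeff k).sub (hQ.continuous_coeff k)
  exists_natDegree_le := by
    obtain ⟨d, hd⟩ := hP.exists_natDegree_le
    obtain ⟨e, he⟩ := hQ.exists_natDegree_le
    exact ⟨max d e, fun x => Polynomial.natDegree_sub_le_of_le (hd x) (he x)⟩

lemma derivative (hP : ContinuousFamily P) :
    ContinuousFamily fun x => Polynomial.derivative (P x) where
  continuous_coeff k := by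
    simp only [Polynomial.coeff_derivative]
    exact (hP.continuous_coeff _).mul continuous_const
  exists_natDegree_le := by
    obtain ⟨d, hd⟩ := hP.exists_natDegree_le
    exact ⟨d, fun x => (Polynomial.natDegree_derivative_le _).trans
      ((Nat.sub_le _ _).trans (hd x))⟩

lemma const (P : ℂ[X]) : ContinuousFamily fun _ : X => P where
  continuous_coeff _ := continuous_const
  exists_natDegree_le := ⟨_, fun _ => le_rfl⟩

lemma derivNum (hP : ContinuousFamily P) (hQ : ContinuousFamily Q) (l : ℕ) :
    ContinuousFamily fun x => derivNum (P x) (Q x) l := by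
  induction l with
  | zero => exact hP
  | succ l ih => exact (ih.derivative.mul hQ).sub ((const _).mul (ih.mul hQ.derivative))

/-- The uniform degree bound turns evaluation into one fixed finite sum, jointly continuous. -/
lemma continuous_eval (hP : ContinuousFamily P) :
    Continuous fun x : X × ℂ => (P x.1).eval x.2 := by
  obtain ⟨d, hd⟩ := hP.exists_natDegree_le
  simp only [fun x => Polynomial.eval_eq_sum_range' (Nat.lt_succ_of_le (hd x))]
  exact continuous_finsetSum _ fun i _ =>
    ((hP.continuous_coeff i).comp continuous_fst).mul (continuous_snd.pow i)

lemma sum_range {c : X → ℕ → ℂ} (hc : ∀ k, Continuous fun x => c x k) (n : ℕ) :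
    ContinuousFamily fun x =>
      ∑ i ∈ Finset.range (n + 1), Polynomial.C (c x i) * Polynomial.X ^ i where
  continuous_coeff k := by
    simp only [coeff_sum_range_C_mul_X_pow]
    split_ifs
    · exact hc k
    · exact continuous_const
  exists_natDegree_le := ⟨n, fun _ => natDegree_sum_range_C_mul_X_pow_le _ _⟩

end ContinuousFamily

section Continuity

variable {X : Type*} [TopologicalSpace X] {a : X → ℕ → ℂ}

lemma continuous_hankel (ha : ∀ v, Continuous fun x => a x v) (p q : ℕ) :
    Continuous fun x => hankel (a x) p q := by
  refine continuous_matrix fun i j => ?_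
  simp only [hankel, Matrix.of_apply, coeffInt]
  split_ifs
  · exact continuous_const
  · exact ha _

lemma continuousFamily_padeDenom (ha : ∀ v, Continuous fun x => a x v) (p q : ℕ) :
    ContinuousFamily fun x => padeDenom (a x) p q := by
  refine .sum_range (fun k => ?_) q
  have hH := continuous_hankel ha p q
  simp only [padeDenomCoeff]
  split_ifs
  · have h1 : Continuous fun x => fun i : Fin q => a x (p + 1 + i) :=
      continuous_pi fun i => ha _
    exact (continuous_apply _).comp (hH.matrix_adjugate.matrix_mulVec h1).neg
  · exact hH.matrix_det

lemma continuousFamily_padeNum (ha : ∀ v, Continuous fun x => a x v) (p q : ℕ) :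
    ContinuousFamily fun x => padeNum (a x) p q := by
  refine .sum_range (fun k => ?_) p
  simp only [PowerSeries.coeff_mul, Polynomial.coeff_coe, PowerSeries.coeff_mk]
  exact continuous_finsetSum _ fun i _ =>
    ((continuousFamily_padeDenom ha p q).continuous_coeff _).mul (ha _)

end Continuity

/-! ### Openness, density and the Baire argument -/

variable {Ω : Set ℂ}

lemma AInf.continuous_taylorCoeff (ζ : closure Ω) (v : ℕ) :
    Continuous fun f : AInf Ω => f.taylorCoeff ζ v :=
  ((continuous_eval_const ζ).comp (continuous_derivExt v)).div_const _

/-- The functions with a Padé approximant of order in `F` that is `1 / (s + 1)`-close to them, with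
the derivatives up to the order `s`, on the part of the closure of `Ω` of norm at most `s`. -/
def padeClose (F : Set (ℕ × ℕ)) (ζ : closure Ω) (s : ℕ) : Set (AInf Ω) :=
  {f | ∃ p q R, (p, q) ∈ F ∧ InD (f.taylorCoeff ζ) p q ∧ IsPade (f.taylorCoeff ζ) p q R ∧
    ∀ z : closure Ω, ‖z.1‖ ≤ s → ¬ HasPole R ζ z ∧ ∀ l ≤ s,
      ‖f.derivExt l z - iteratedDeriv l (ratValue R ζ) z‖ < 1 / ((s : ℝ) + 1)}

/-- The pair `(p, q)` that serves `f₀` also serves nearby `f`: nonvanishing of the Hankel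
determinant is an open condition, and so are absence of a pole and the strict estimates, jointly in
`(f, z)`. -/
lemma isOpen_padeClose (F : Set (ℕ × ℕ)) (ζ : closure Ω) (s : ℕ) :
    IsOpen (padeClose F ζ s) := by
  have : LocallyCompactSpace (closure Ω) := isClosed_closure.locallyCompactSpace
  refine isOpen_iff_mem_nhds.2 ?_
  rintro f₀ ⟨p, q, R₀, hF, hD, hR₀, hz₀⟩
  set a : AInf Ω → ℕ → ℂ := fun f => f.taylorCoeff ζ
  have ha : ∀ v, Continuous fun f => a f v := AInf.continuous_taylorCoeff ζ
  set N : AInf Ω → ℂ[X] := fun f => padeNum (a f) p q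
  set D : AInf Ω → ℂ[X] := fun f => padeDenom (a f) p q
  have hNc : ContinuousFamily N := continuousFamily_padeNum ha p q
  have hDc : ContinuousFamily D := continuousFamily_padeDenom ha p q
  have hev : ∀ {P : AInf Ω → ℂ[X]}, ContinuousFamily P →
      Continuous fun x : AInf Ω × closure Ω => (P x.1).eval (x.2.1 - ζ) := fun hP =>
    hP.continuous_eval.comp (by fun_prop :
      Continuous fun x : AInf Ω × closure Ω => (x.1, x.2.1 - (ζ : ℂ)))
  have hval : ∀ {f : AInf Ω} {R : RatFunc ℂ}, InD (a f) p q → IsPade (a f) p q R →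
      ∀ {z : ℂ}, (D f).eval (z - ζ) ≠ 0 → ∀ l, iteratedDeriv l (ratValue R ζ) z =
        (derivNum (N f) (D f) l).eval (z - ζ) / (D f).eval (z - ζ) ^ (l + 1) :=
    fun {f R} hD hR z hz l => by
      rw [funext (ratValue_eq_padeNum_div_padeDenom hD hR (ζ : ℂ))]
      exact iteratedDeriv_div _ _ _ _ hz
  have hdet : ∀ᶠ f in 𝓝 f₀, InD (a f) p q :=
    ((continuous_hankel ha p q).matrix_det).continuousAt.eventually_ne hD
  have hclose : ∀ᶠ f in 𝓝 f₀, ∀ z ∈ {z : closure Ω | ‖z.1‖ ≤ s},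
      (D f).eval (z.1 - ζ) ≠ 0 ∧ ∀ l ∈ Finset.range (s + 1), ‖f.derivExt l z -
        (derivNum (N f) (D f) l).eval (z.1 - ζ) / (D f).eval (z.1 - ζ) ^ (l + 1)‖ <
          1 / ((s : ℝ) + 1) := by
    -- The tube lemma: neighbourhoods of the points `(f₀, z)` give one neighbourhood of `f₀` valid
    -- for all `z` of the compact set.
    refine (AInf.isCompact_norm_le s).eventually_forall_of_forall_eventually fun z hz => ?_
    obtain ⟨hpole, hl⟩ := hz₀ z hz
    have hDz : (D f₀).eval (z.1 - ζ) ≠ 0 := fun h =>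
      hpole ((hasPole_iff_eval_padeDenom hD hR₀ _ _).2 h)
    refine ((hev hDc).continuousAt.eventually_ne (x := (f₀, z)) hDz).and
      ((Finset.eventually_all _).2 fun l hls => ?_)
    have h1 : Continuous fun x : AInf Ω × closure Ω => x.1.derivExt l x.2 :=
      ((AInf.continuous_derivExt l).comp continuous_fst).eval continuous_snd
    have h2 : ContinuousAt (fun x : AInf Ω × closure Ω => ‖x.1.derivExt l x.2 -
        (derivNum (N x.1) (D x.1) l).eval (x.2.1 - ζ) /
          (D x.1).eval (x.2.1 - ζ) ^ (l + 1)‖) (f₀, z) :=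
      (h1.continuousAt.sub ((hev (hNc.derivNum hDc l)).continuousAt.div
        ((hev hDc).continuousAt.pow _) (pow_ne_zero _ hDz))).norm
    refine h2.eventually_lt continuousAt_const ?_
    have h3 := hl l (by simpa [Nat.lt_succ_iff] using hls)
    rwa [hval hD hR₀ hDz] at h3
  filter_upwards [hdet, hclose] with f hf hfz
  obtain ⟨R, hR⟩ := exists_isPade hf
  refine ⟨p, q, R, hF, hf, hR, fun z hz => ?_⟩
  obtain ⟨hDz, hl⟩ := hfz z hz
  refine ⟨fun h => hDz ((hasPole_iff_eval_padeDenom hf hR _ _).1 h), fun l hls => ?_⟩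
  rw [hval hf hR hDz]
  exact hl l (Finset.mem_range.2 (by omega))

lemma PadeApproximable.exists_close {F : Set (ℕ × ℕ)} {ζ : closure Ω} {f : AInf Ω}
    (hf : PadeApproximable F ζ f) (s : ℕ) {ε : ℝ} (hε : 0 < ε) :
    ∃ p q R, (p, q) ∈ F ∧ InD (f.taylorCoeff ζ) p q ∧ IsPade (f.taylorCoeff ζ) p q R ∧
      ∀ z : closure Ω, ‖z.1‖ ≤ s → ¬ HasPole R ζ z ∧ ∀ l ≤ s,
        ‖f.derivExt l z - iteratedDeriv l (ratValue R ζ) z‖ < ε := by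
  obtain ⟨p, q, R, hF, hD, hR, h⟩ := hf
  obtain ⟨hpole, hlim⟩ := h _ (AInf.isCompact_norm_le s)
  have hev : ∀ᶠ n in atTop, ∀ l ∈ Finset.range (s + 1), ∀ z ∈ {z : closure Ω | ‖z.1‖ ≤ s},
      dist (f.derivExt l z) (iteratedDeriv l (ratValue (R n) ζ) z) < ε :=
    (Finset.eventually_all _).2 fun l _ => Metric.tendstoUniformlyOn_iff.1 (hlim l) ε hε
  obtain ⟨n, hn1, hn2⟩ := (hpole.and hev).exists
  refine ⟨p n, q n, R n, hF n, hD n, hR n, fun z hz => ⟨hn1 z hz, fun l hl => ?_⟩⟩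
  rw [← dist_eq_norm]
  exact hn2 l (Finset.mem_range.2 (by omega)) z hz

/-- Every compact subset lies in some `{‖z‖ ≤ s}`, so one approximant chosen for each `s` gives the
required sequence. -/
lemma padeApproximable_iff {F : Set (ℕ × ℕ)} {ζ : closure Ω} {f : AInf Ω} :
    PadeApproximable F ζ f ↔ ∀ s, f ∈ padeClose F ζ s := by
  refine ⟨fun hf s => hf.exists_close s Nat.one_div_pos_of_nat, fun hf => ?_⟩
  choose p q R hF hD hR h using hf
  refine ⟨p, q, R, hF, hD, hR, fun K hK => ?_⟩
  obtain ⟨m, hm⟩ := AInf.exists_nat_norm_le_of_isCompact hK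
  have hle : ∀ {n}, m ≤ n → ∀ z ∈ K, ‖z.1‖ ≤ n := fun hmn z hz =>
    (hm z hz).trans (by exact_mod_cast hmn)
  constructor
  · filter_upwards [eventually_ge_atTop m] with n hn z hz using (h n z (hle hn z hz)).1
  · intro l
    rw [Metric.tendstoUniformlyOn_iff]
    intro ε hε
    filter_upwards [tendsto_one_div_add_atTop_nhds_zero_nat.eventually (gt_mem_nhds hε),
      eventually_ge_atTop l, eventually_ge_atTop m] with n hn hln hmn z hz
    rw [dist_eq_norm]
    exact ((h n z (hle hmn z hz)).2 l hln).trans hn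

lemma setOf_padeApproximable_eq_iInter (F : Set (ℕ × ℕ)) (ζ : closure Ω) :
    {f : XInf Ω | PadeApproximable F ζ f.1} =
      ⋂ s, (Subtype.val : XInf Ω → AInf Ω) ⁻¹' padeClose F ζ s := by
  ext f
  simp [padeApproximable_iff]

/-- The approximants may have poles in the closure of `Ω` far out, so they need not belong to
`holoNearClosure Ω`; Runge's theorem on each bounded part replaces them by polynomials. -/
lemma PadeApproximable.mem_XInf (hΩ : IsOpen Ω)
    (hconn : IsConnected (((fun z : ℂ => (z : OnePoint ℂ)) '' closure Ω)ᶜ)) {F : Set (ℕ × ℕ)}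
    {ζ : closure Ω} {f : AInf Ω} (hf : PadeApproximable F ζ f) : f ∈ XInf Ω := by
  rw [XInf_eq_closure_polynomialRestrictions hΩ hconn]
  refine mem_closure_polynomialRestrictions hΩ hconn fun n ε hε => ?_
  obtain ⟨p, q, R, -, -, -, h⟩ := hf.exists_close n hε
  refine ⟨{z | R.denom.eval (z - ζ) ≠ 0}, ratValue R ζ,
    isOpen_ne_fun (by fun_prop) (by fun_prop), fun z hz => ?_, fun z hz => ?_, fun l hl z hz =>
      (h z hz).2 l hl⟩
  · exact (h ⟨z, hz.1⟩ (by simpa using hz.2)).1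
  · have hP : ∀ P : ℂ[X], DifferentiableAt ℂ (fun z => P.eval (z - ζ.1)) z := fun P =>
      P.differentiable.differentiableAt.comp z (by fun_prop)
    exact ((hP _).div (hP _) hz).differentiableWithinAt

lemma AInf.taylorCoeff_ofPolynomial (hΩ : IsOpen Ω) (P : ℂ[X]) (ζ : closure Ω) (v : ℕ) :
    (ofPolynomial hΩ P).taylorCoeff ζ v = (Polynomial.taylor ζ.1 P).coeff v := by
  rw [taylorCoeff, derivExt_of_eq_polynomial hΩ (f := ofPolynomial hΩ P) (P := P) (fun _ => rfl),
    Polynomial.taylor_coeff, ← Polynomial.factorial_smul_hasseDeriv, LinearMap.smul_apply,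
    Polynomial.eval_smul, nsmul_eq_mul,
    mul_div_cancel_left₀ _ (Nat.cast_ne_zero.2 v.factorial_ne_zero)]

/-- A polynomial of degree `p` is its own Padé approximant of order `(p, q)`. -/
lemma ofPolynomial_mem_padeClose (hΩ : IsOpen Ω) {F : Set (ℕ × ℕ)} {p q : ℕ} (hF : (p, q) ∈ F)
    (ζ : closure Ω) {P : ℂ[X]} (hP : P ≠ 0) (hPp : P.natDegree = p) (s : ℕ) :
    AInf.ofPolynomial hΩ P ∈ padeClose F ζ s := by
  have ha := AInf.taylorCoeff_ofPolynomial hΩ P ζ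
  have hdeg : (Polynomial.taylor ζ.1 P).natDegree = p := by rw [Polynomial.natDegree_taylor, hPp]
  have hD : InD ((AInf.ofPolynomial hΩ P).taylorCoeff ζ) p q := by
    refine inD_of_polynomial ?_ (fun v hv => ?_) q
    · rw [ha, ← hPp, Polynomial.coeff_taylor_natDegree]
      exact Polynomial.leadingCoeff_ne_zero.2 hP
    · rw [ha, Polynomial.coeff_eq_zero_of_natDegree_lt (by omega)]
  have hpair := isPadePair_of_polynomial q hdeg.le ha
  have hR := isPade_iff.2 ⟨_, _, hpair, rfl⟩
  refine ⟨p, q, _, hF, hD, hR, fun z _ => ⟨fun h => ?_, fun l _ => ?_⟩⟩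
  · rw [hpair.hasPole_iff hD hR, Polynomial.eval_one] at h
    exact one_ne_zero h
  · have hval : ratValue _ ζ.1 = fun z => P.eval z := funext fun z => by
      rw [hpair.ratValue_eq hD hR, Polynomial.eval_one, div_one, Polynomial.taylor_eval,
        sub_add_cancel]
    rw [hval, iteratedDeriv_polynomial, AInf.derivExt_of_eq_polynomial hΩ (P := P) (fun _ => rfl),
      sub_self, norm_zero]
    exact Nat.one_div_pos_of_nat

lemma AInf.continuous_ofPolynomial (hΩ : IsOpen Ω) {X : Type*} [TopologicalSpace X] {P : X → ℂ[X]}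
    (hP : ContinuousFamily P) : Continuous fun x => ofPolynomial hΩ (P x) := by
  refine isInducing_derivExt.continuous_iff.2 (continuous_pi fun l => ?_)
  refine ContinuousMap.continuous_of_continuous_uncurry _ ?_
  have h : ContinuousFamily fun x => Polynomial.derivative^[l] (P x) := by
    induction l with
    | zero => exact hP
    | succ l ih =>
      simp only [Function.iterate_succ_apply']
      exact ih.derivative
  refine (h.continuous_eval.comp (by fun_prop :
    Continuous fun y : X × closure Ω => (y.1, y.2.1))).congr fun y => ?_
  exact (derivExt_of_eq_polynomial hΩ (f := ofPolynomial hΩ (P y.1)) (fun _ => rfl) l y.2).symm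

lemma polynomialRestrictions_subset_closure (hΩ : IsOpen Ω) {F : Set (ℕ × ℕ)}
    (hF : ∃ pt qt : ℕ → ℕ, (∀ n, (pt n, qt n) ∈ F) ∧ Tendsto pt atTop atTop) (ζ : closure Ω)
    (s : ℕ) :
    polynomialRestrictions Ω ⊆ closure (polynomialRestrictions Ω ∩ padeClose F ζ s) := by
  rintro f ⟨P, hP⟩
  obtain ⟨pt, qt, hF, hpt⟩ := hF
  obtain ⟨n, hn⟩ := (hpt.eventually_gt_atTop P.natDegree).exists
  set p := pt n
  -- As `p` exceeds the degree of `P`, the perturbation has degree exactly `p` for every `c ≠ 0`,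
  -- and it tends to `P` as `c → 0`.
  set G : ℂ → ℂ[X] := fun c => P + Polynomial.C c * Polynomial.X ^ p with hG
  have hdeg : ∀ c, c ≠ 0 → (G c).natDegree = p := fun c hc => by
    rw [hG]
    simp only
    rw [Polynomial.natDegree_add_eq_right_of_natDegree_lt] <;>
      rw [Polynomial.natDegree_C_mul_X_pow _ _ hc]
    exact hn
  have hGc : ContinuousFamily G := by
    refine ⟨fun k => ?_, max P.natDegree p, fun c => ?_⟩
    · simp only [hG, Polynomial.coeff_add, Polynomial.coeff_C_mul]
      fun_prop
    · exact Polynomial.natDegree_add_le_of_le le_rfl (Polynomial.natDegree_C_mul_X_pow_le _ _)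
  have hf : AInf.ofPolynomial hΩ (G 0) = f :=
    Subtype.ext (funext fun z => by simpa [hG, AInf.ofPolynomial] using (hP z).symm)
  rw [← hf]
  have h0 : (0 : ℂ) ∈ closure {c : ℂ | c ≠ 0} := by
    have : closure ({0}ᶜ : Set ℂ) = Set.univ := closure_compl_singleton 0
    exact this ▸ Set.mem_univ _
  refine map_mem_closure (f := fun c => AInf.ofPolynomial hΩ (G c))
    (AInf.continuous_ofPolynomial hΩ hGc) h0 fun c hc => ?_
  refine ⟨⟨G c, fun _ => rfl⟩, ofPolynomial_mem_padeClose hΩ (hF n) ζ ?_ (hdeg c hc) s⟩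
  intro h
  have := hdeg c hc
  rw [h, Polynomial.natDegree_zero] at this
  omega

lemma dense_padeApproximable (hΩ : IsOpen Ω)
    (hconn : IsConnected (((fun z : ℂ => (z : OnePoint ℂ)) '' closure Ω)ᶜ)) {F : Set (ℕ × ℕ)}
    (hF : ∃ pt qt : ℕ → ℕ, (∀ n, (pt n, qt n) ∈ F) ∧ Tendsto pt atTop atTop) (ζ : closure Ω) :
    Dense {f : XInf Ω | PadeApproximable F ζ f.1} := by
  have hX := XInf_eq_closure_polynomialRestrictions hΩ hconn
  have : BaireSpace (XInf Ω) := AInf.baireSpace_of_isClosed hΩ isClosed_closure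
  rw [setOf_padeApproximable_eq_iInter]
  refine dense_iInter_of_isOpen_nat
    (fun s => (isOpen_padeClose F ζ s).preimage continuous_subtype_val) fun s f => ?_
  rw [closure_subtype]
  have hf : f.1 ∈ closure (polynomialRestrictions Ω) := hX ▸ f.2
  -- Polynomials are dense in `XInf Ω`, and each is a limit of polynomials in `padeClose F ζ s`.
  have h1 := closure_minimal (polynomialRestrictions_subset_closure hΩ hF ζ s) isClosed_closure hf
  refine closure_mono (fun g hg => ?_) h1
  exact ⟨⟨g, hX ▸ subset_closure hg.1⟩, hg.2, rfl⟩

end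

theorem theorem4p6 (Ω : Set ℂ) (hΩ : IsOpen Ω)
    (hconn : IsConnected (((fun z : ℂ => (z : OnePoint ℂ)) '' closure Ω)ᶜ))
    (F : Set (ℕ × ℕ))
    (hF : ∃ pt qt : ℕ → ℕ, (∀ n, (pt n, qt n) ∈ F) ∧ Tendsto pt atTop atTop)
    (ζ₀ : closure Ω) :
    (∃ f : AInf Ω, PadeApproximable F ζ₀ f) ∧
    {f : AInf Ω | PadeApproximable F ζ₀ f} ⊆ XInf Ω ∧
    IsGδ {f : XInf Ω | PadeApproximable F ζ₀ f.1} ∧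
    Dense {f : XInf Ω | PadeApproximable F ζ₀ f.1} ∧
    XInf Ω = closure (polynomialRestrictions Ω) := by
  have hX := XInf_eq_closure_polynomialRestrictions hΩ hconn
  have hdense := dense_padeApproximable hΩ hconn hF ζ₀
  refine ⟨?_, fun f hf => hf.mem_XInf hΩ hconn, ?_, hdense, hX⟩
  · have : Nonempty (XInf Ω) :=
      ⟨AInf.ofPolynomial hΩ 0, hX ▸ subset_closure ⟨0, fun _ => rfl⟩⟩
    obtain ⟨f, hf⟩ := hdense.nonempty
    exact ⟨f.1, hf⟩
  · rw [setOf_padeApproximable_eq_iInter]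
    exact IsGδ.iInter_of_isOpen fun s =>
      (isOpen_padeClose F ζ₀ s).preimage continuous_subtype_val
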